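/- For a word $w=(s_1,\ldots,s_r)$ of positive integers let $\mathrm H_w(N)=\sum_{N\ge n_1>\cdots>n_r>0}n_1^{-s_1}\cdots n_r^{-s_r}$ and, when the series converges, $\zeta(w)=\sum_{n_1>\cdots>n_r>0}n_1^{-s_1}\cdots n_r^{-s_r}$ (both equal to $1$ for the empty word). Let $\gamma_w$ be the finite part of $\mathrm H_w(n)$ as $n\to\infty$, i.e. the constant term of the polynomial $P$ with $\mathrm H_w(n)=P(\log n)+o(1)$. Write $\{w\}^k$ for $w$ repeated $k$ times, and for $c\in\mathbb C$ put $\gamma_{(c\,w)^*}=\sum_{k\ge0}c^k\gamma_{\{w\}^k}$ and $\zeta((c\,w)^*)=\sum_{k\ge0}c^k\zeta(\{w\}^k)$. For $|z|<1$ let $$\ell_1(z)=\gamma z-\sum_{k\ge2}\zeta(k)\frac{(-z)^k}{k},\qquad \ell_r(z)=-\sum_{k\ge1}\zeta(kr)\frac{(-z^r)^k}{k}\ (r\ge2),\qquad \Gamma_{y_r}(1+z)=e^{-\ell_r(z)},$$ where $\gamma$ is Euler's constant; $y_s$ denotes the one-letter word $(s)$ and $y_3y_1$ the word $(3,1)$.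 For all $r\ge1$, $k\ge0$ the finite part $\gamma_{\{r\}^k}$ exists, and the following hold. 1. For every $t\in\mathbb C$ with $|t|<1$ all the series involved converge, and $$\gamma_{(-t^2y_2)^*}=\Gamma_{y_2}^{-1}(1+\mathrm it),\quad \gamma_{(ty_1)^*}=\Gamma_{y_1}^{-1}(1+t),\quad \gamma_{(-ty_1)^*}=\Gamma_{y_1}^{-1}(1-t),$$ $$\gamma_{(-t^2y_2)^*}=\gamma_{(ty_1)^*}\gamma_{(-ty_1)^*},\quad\text{that is}\quad \Gamma_{y_2}^{-1}(1+\mathrm it)=\Gamma_{y_1}^{-1}(1+t)\,\Gamma_{y_1}^{-1}(1-t),$$ $$\Gamma_{y_2}^{-1}(1+\mathrm it)=e^{-\sum_{k\ge1}\zeta(2k)t^{2k}/k}=\frac{\sin(t\pi)}{t\pi},\qquad \gamma_{(-t^2y_2)^*}=\zeta((-t^2y_2)^*)=\sum_{k\ge0}\frac{(t\mathrm i\pi)^{2k}}{(2k+1)!}$$ (the quotient with $t$ in the denominator for $t\neq0$). 2. For every $t\in\mathbb C$ with $|t|<1$ and every $\xi$ with $\xi^4=-1$ all the series involved converge, and $$\gamma_{(-t^4y_4)^*}=\Gamma_{y_4}^{-1}(1+\xi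 t)=\Gamma_{y_2}^{-1}(1+t)\,\Gamma_{y_2}^{-1}(1+\mathrm it),\quad \gamma_{(t^2y_2)^*}=\Gamma_{y_2}^{-1}(1+t),\quad \gamma_{(-t^4y_4)^*}=\gamma_{(t^2y_2)^*}\gamma_{(-t^2y_2)^*},$$ $$\gamma_{(-t^4y_4)^*}=e^{-\sum_{k\ge1}\zeta(4k)t^{4k}/k}=\frac{\sin(\mathrm it\pi)}{\mathrm it\pi}\,\frac{\sin(t\pi)}{t\pi},\qquad \gamma_{(-t^4y_4)^*}=\zeta((-t^4y_4)^*),\quad \gamma_{(t^2y_2)^*}=\zeta((t^2y_2)^*),$$ $$\zeta((-t^4y_4)^*)=\zeta((-t^2y_2)^*)\,\zeta((t^2y_2)^*)=\zeta((-4t^4y_3y_1)^*)=\sum_{k\ge0}\frac{2(-4)^k(t\pi)^{4k}}{(4k+2)!}$$ (again the quotients for $t\neq0$). 3. For every $k\ge0$ the series $\zeta(\{2\}^k)$, $\zeta(\{4\}^k)$, $\zeta(\{3,1\}^k)$ converge, and $$\frac{\zeta(\{2\}^k)}{\pi^{2k}}=\frac1{(2k+1)!}\in\mathbb Q,\qquad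 \frac{\zeta(\{4\}^k)}{4^k\pi^{4k}}=\frac{\zeta(\{3,1\}^k)}{\pi^{4k}}=\frac{2}{(4k+2)!}\in\mathbb Q.$$ -/

import Mathlib

open Filter Topology

noncomputable section

namespace Polyzeta

/-- Words `y_{s_1} ... y_{s_r}` over the alphabet `Y = {y_s}_{s ≥ 1}` are lists `[s_1, ..., s_r]`;
`wordPow w k` is the word `w` repeated `k` times, e.g. `wordPow [3, 1] k = {3,1}^k`. -/
def wordPow (w : List ℕ) (k : ℕ) : List ℕ := (List.replicate k w).flatten

/-- The index set `n_1 > ... > n_r > 0`. -/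
abbrev Decreasing (r : ℕ) : Type := {n : Fin r → ℕ // StrictAnti n ∧ ∀ i, 0 < n i}

/-- The general term `n_1^{-s_1} ... n_r^{-s_r}`. -/
def term (s : List ℕ) (n : Fin s.length → ℕ) : ℝ := ∏ i, ((n i : ℝ) ^ s.get i)⁻¹

/-- The series over `n_1 > ... > n_r > 0` that defines `ζ(s_1, ..., s_r)` converges. -/
def Converges (s : List ℕ) : Prop := Summable fun n : Decreasing s.length => term s n.1

/-- The polyzeta `ζ(s_1, ..., s_r)`, the sum over `n_1 > ... > n_r > 0` of
`n_1^{-s_1} ... n_r^{-s_r}`. -/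
def zeta (s : List ℕ) : ℝ := ∑' n : Decreasing s.length, term s n.1

open Classical in
/-- The harmonic sum `H_{s_1, ..., s_r}(N)`, the sum over `N ≥ n_1 > ... > n_r > 0`. -/
def harmonicSum (s : List ℕ) (N : ℕ) : ℝ :=
  ∑ n ∈ (Fintype.piFinset fun _ : Fin s.length => Finset.Icc 1 N).filter StrictAnti, term s n

/-- `c` is the finite part of `u` as `n → ∞` in the scale of the powers of `log n`:
`u n = P (log n) + o(1)` for a polynomial `P` with constant term `c`. (For harmonic sums with positive
indices no positive power of `n` occurs, and the terms with a negative power of `n` are `o(1)`.) -/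
def IsFinitePart (u : ℕ → ℝ) (c : ℝ) : Prop :=
  ∃ P : Polynomial ℝ, P.coeff 0 = c ∧
    Tendsto (fun n : ℕ => u n - P.eval (Real.log n)) atTop (𝓝 0)

/-- The finite part is unique. -/
theorem IsFinitePart.unique {u : ℕ → ℝ} {c d : ℝ} (hc : IsFinitePart u c)
    (hd : IsFinitePart u d) : c = d := by
  obtain ⟨P, rfl, hP⟩ := hc
  obtain ⟨Q, rfl, hQ⟩ := hd
  have hlog : Tendsto (fun n : ℕ => Real.log n) atTop atTop :=
    Real.tendsto_log_atTop.comp tendsto_natCast_atTop_atTop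
  have h : Tendsto (fun n : ℕ => (P - Q).eval (Real.log n)) atTop (𝓝 0) := by
    have := hQ.sub hP
    simp only [sub_zero] at this
    refine this.congr fun n => ?_
    simp
  by_cases hdeg : 0 < (P - Q).degree
  · have h2 := ((P - Q).abs_tendsto_atTop hdeg).comp hlog
    exact absurd h.abs (not_tendsto_nhds_of_tendsto_atTop h2 _)
  · rw [Polynomial.eq_C_of_degree_le_zero (not_lt.mp hdeg)] at h
    simp only [Polynomial.eval_C] at h
    have := tendsto_nhds_unique h tendsto_const_nhds
    simp only [Polynomial.coeff_sub] at this
    linarith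

open Classical in
/-- The regularization `γ_w`, the finite part of `H_w(n)` as `n → ∞` in the scale of the powers
of `log n` (so `γ_{y_1}` is Euler's constant). -/
def gammaReg (w : List ℕ) : ℝ :=
  if h : ∃ c, IsFinitePart (harmonicSum w) c then h.choose else 0

/-- The degreewise evaluation of `χ` at the Kleene star `(c w)^* = ∑_k c^k w^k` converges. -/
def StarConverges (χ : List ℕ → ℝ) (c : ℂ) (w : List ℕ) : Prop :=
  Summable fun k : ℕ => c ^ k * (χ (wordPow w k) : ℂ)

/-- The value of `χ` at the Kleene star `(c w)^* = ∑_k c^k w^k`. -/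
def starValue (χ : List ℕ → ℝ) (c : ℂ) (w : List ℕ) : ℂ :=
  ∑' k : ℕ, c ^ k * (χ (wordPow w k) : ℂ)

/-- `ℓ_1(z) = γ z - ∑_{k ≥ 2} ζ(k) (-z)^k / k`, and `ℓ_r(z) = - ∑_{k ≥ 1} ζ(k r) (-z^r)^k / k` for
`r ≥ 2`; used for `|z| < 1` only. -/
def ell (r : ℕ) (z : ℂ) : ℂ :=
  if r = 1 then
    Real.eulerMascheroniConstant * z
      - ∑' k : ℕ, riemannZeta ((k + 2 : ℕ) : ℂ) * (-z) ^ (k + 2) / ((k + 2 : ℕ) : ℂ)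
  else
    - ∑' k : ℕ, riemannZeta (((k + 1) * r : ℕ) : ℂ) * (-z ^ r) ^ (k + 1) / ((k + 1 : ℕ) : ℂ)

/-- The eulerian function `Γ_{y_r}`, with `Γ_{y_r}(1 + z) = exp (-ℓ_r(z))` for `|z| < 1`. -/
def GammaY (r : ℕ) (a : ℂ) : ℂ := Complex.exp (-ell r (a - 1))

end Polyzeta

end

/-!
For fixed `r` and `N`, the sums `H_{{r}^k}(N)` are the elementary symmetric functions of the numbers
`j ^ (-r)`, `1 ≤ j ≤ N`, whose power sums are the `H_{(rk)}(N)`. Newton's identities survive the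
passage to finite parts. On generating functions they say `F' = F * S`, hence
`∑_k c^k γ_{{r}^k} = exp ℓ_r(z)` with `c = z ^ r`. The relations between the `Γ_{y_r}` follow, since
in `ℓ_r(z) + ℓ_r(z')` with `z' ^ r = -z ^ r` only every other term survives.

For `r ≥ 2` the star values of `ζ` are the infinite products `∏_j (1 + c j ^ (-r))`, by dominated
convergence. For `r = 2` this is Euler's product for the sine, and pairing the factors for `c` and
`-c` leads from `r` to `2 r`.

For `(3, 1)` the point is the shuffle identity
`∑_{a + b = 2n} (-1)^b ζ({2}^a) ζ({2}^b) = (-4)^n ζ({3,1}^n)`. It already holds between the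
polylogarithms as formal power series, where it follows from the differential equations of
`Li_{{2}^k}` and `Li_{1{2}^k}` by uniqueness of primitives. Summing coefficients passes to `ζ`, and
comparing with the power series of the sine gives the closed formulas.
-/

noncomputable section

namespace Polyzeta

/-! ### Harmonic sums -/

/-- The harmonic sum `H_w(N)`, built by recursion on the word: the summand `m` collects the terms
whose largest index is `n_1 = m + 1`. -/
def hsum : List ℕ → ℕ → ℝ
  | [], _ => 1
  | s :: w, N => ∑ m ∈ Finset.range N, (((m + 1 : ℕ) : ℝ) ^ s)⁻¹ * hsum w m

@[simp] theorem hsum_nil (N : ℕ) : hsum [] N = 1 := rfl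

theorem hsum_cons (s : ℕ) (w : List ℕ) (N : ℕ) :
    hsum (s :: w) N = ∑ m ∈ Finset.range N, (((m + 1 : ℕ) : ℝ) ^ s)⁻¹ * hsum w m := rfl

@[simp] theorem hsum_cons_zero (s : ℕ) (w : List ℕ) : hsum (s :: w) 0 = 0 := by simp [hsum_cons]

theorem hsum_cons_succ (s : ℕ) (w : List ℕ) (N : ℕ) :
    hsum (s :: w) (N + 1) = hsum (s :: w) N + (((N + 1 : ℕ) : ℝ) ^ s)⁻¹ * hsum w N := by
  simp only [hsum_cons, Finset.sum_range_succ]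

theorem hsum_singleton (s N : ℕ) :
    hsum [s] N = ∑ m ∈ Finset.range N, (((m + 1 : ℕ) : ℝ) ^ s)⁻¹ := by
  simp [hsum_cons]

theorem hsum_nonneg (w : List ℕ) (N : ℕ) : 0 ≤ hsum w N := by
  induction w generalizing N with
  | nil => simp
  | cons s w ih => exact Finset.sum_nonneg fun m _ => mul_nonneg (by positivity) (ih m)

theorem hsum_mono (w : List ℕ) : Monotone (hsum w) := by
  cases w with
  | nil => exact monotone_const
  | cons s w =>
    refine monotone_nat_of_le_succ fun N => ?_
    rw [hsum_cons_succ]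
    exact le_add_of_nonneg_right (mul_nonneg (by positivity) (hsum_nonneg w N))

open Classical in
/-- The index set `N ≥ n_1 > ... > n_r > 0` of a harmonic sum. -/
def decreasingUpTo (r N : ℕ) : Finset (Fin r → ℕ) :=
  (Fintype.piFinset fun _ : Fin r => Finset.Icc 1 N).filter StrictAnti

theorem mem_decreasingUpTo {r N : ℕ} {n : Fin r → ℕ} :
    n ∈ decreasingUpTo r N ↔ (∀ i, 0 < n i ∧ n i ≤ N) ∧ StrictAnti n := by
  simp [decreasingUpTo, Fintype.mem_piFinset, Nat.succ_le_iff]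

theorem strictAnti_cons {α : Type*} [Preorder α] {r : ℕ} {a : α} {f : Fin r → α} :
    StrictAnti (Fin.cons a f : Fin (r + 1) → α) ↔ (∀ i, f i < a) ∧ StrictAnti f := by
  simp [StrictAnti, Fin.forall_fin_succ]

theorem cons_mem_decreasingUpTo {r N m : ℕ} {f : Fin r → ℕ} :
    (Fin.cons (m + 1) f : Fin (r + 1) → ℕ) ∈ decreasingUpTo (r + 1) N ↔
      m < N ∧ f ∈ decreasingUpTo r m := by
  simp only [mem_decreasingUpTo, strictAnti_cons, Fin.forall_fin_succ, Fin.cons_zero, Fin.cons_succ,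
    Nat.lt_succ_iff, Nat.succ_le_iff]
  exact ⟨fun h => ⟨h.1.1.2, fun i => ⟨(h.1.2 i).1, h.2.1 i⟩, h.2.2⟩,
    fun h => ⟨⟨⟨m.zero_le, h.1⟩, fun i => ⟨(h.2.1 i).1, (h.2.1 i).2.trans h.1.le⟩⟩,
      fun i => (h.2.1 i).2, h.2.2⟩⟩

theorem sum_decreasingUpTo_succ {M : Type*} [AddCommMonoid M] (r N : ℕ)
    (g : (Fin (r + 1) → ℕ) → M) :
    ∑ n ∈ decreasingUpTo (r + 1) N, g n =
      ∑ m ∈ Finset.range N, ∑ f ∈ decreasingUpTo r m, g (Fin.cons (m + 1) f) := by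
  rw [Finset.sum_sigma']
  have cons_sub_one : ∀ n ∈ decreasingUpTo (r + 1) N, Fin.cons (n 0 - 1 + 1) (Fin.tail n) = n := by
    intro n hn
    rw [Nat.sub_add_cancel ((mem_decreasingUpTo.1 hn).1 0).1]
    exact Fin.cons_self_tail (α := fun _ => ℕ) n
  refine Finset.sum_bij' (fun n _ => ⟨n 0 - 1, Fin.tail n⟩) (fun p _ => Fin.cons (p.1 + 1) p.2)
    ?_ ?_ cons_sub_one ?_ ?_
  · intro n hn
    rw [← cons_sub_one n hn, cons_mem_decreasingUpTo] at hn
    simpa only [Finset.mem_sigma, Finset.mem_range] using hn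
  · intro p hp
    simpa only [Finset.mem_sigma, Finset.mem_range, cons_mem_decreasingUpTo] using hp
  · intro p _
    simp
  · intro n hn
    rw [cons_sub_one n hn]

theorem term_cons (s : ℕ) (w : List ℕ) (a : ℕ) (f : Fin w.length → ℕ) :
    term (s :: w) (Fin.cons a f : Fin (w.length + 1) → ℕ) = ((a : ℝ) ^ s)⁻¹ * term w f :=
  (Fin.prod_univ_succ (n := w.length) _).trans (by simp [term])

theorem sum_term_eq_hsum (w : List ℕ) (N : ℕ) :
    ∑ n ∈ decreasingUpTo w.length N, term w n = hsum w N := by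
  induction w generalizing N with
  | nil => simp [decreasingUpTo, term, Subsingleton.strictAnti]
  | cons s w ih =>
    refine (sum_decreasingUpTo_succ w.length N (term (s :: w))).trans ?_
    simp_rw [term_cons, ← Finset.mul_sum, ih, hsum_cons]

theorem harmonicSum_eq_hsum (w : List ℕ) : harmonicSum w = hsum w :=
  funext (sum_term_eq_hsum w)

theorem term_nonneg (w : List ℕ) (n : Fin w.length → ℕ) : 0 ≤ term w n :=
  Finset.prod_nonneg fun _ _ => by positivity

/-- The truncation at `n_1 ≤ N` of the index set `n_1 > ... > n_r > 0` of `ζ`; as `N` grows these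
finite sets exhaust the index set, so sums over them compute `ζ`. -/
def decreasingTruncation (r N : ℕ) : Finset (Decreasing r) :=
  (decreasingUpTo r N).subtype fun n => StrictAnti n ∧ ∀ i, 0 < n i

theorem mem_decreasingTruncation {r N : ℕ} {n : Decreasing r} :
    n ∈ decreasingTruncation r N ↔ ∀ i, n.1 i ≤ N := by
  simp only [decreasingTruncation, Finset.mem_subtype, mem_decreasingUpTo]
  exact ⟨fun h i => (h.1 i).2, fun h => ⟨fun i => ⟨n.2.2 i, h i⟩, n.2.1⟩⟩

theorem sum_decreasingTruncation (w : List ℕ) (N : ℕ) :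
    ∑ n ∈ decreasingTruncation w.length N, term w n.1 = hsum w N := by
  rw [← sum_term_eq_hsum, decreasingTruncation]
  refine Finset.sum_subtype_of_mem (term w) fun n hn => ?_
  rw [mem_decreasingUpTo] at hn
  exact ⟨hn.2, fun i => (hn.1 i).1⟩

theorem tendsto_decreasingTruncation (r : ℕ) : Tendsto (decreasingTruncation r) atTop atTop := by
  refine tendsto_atTop_finset_of_monotone (fun M N h n hn => ?_) fun n => ⟨∑ i, n.1 i, ?_⟩
  · exact mem_decreasingTruncation.2 fun i => (mem_decreasingTruncation.1 hn i).trans h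
  · exact mem_decreasingTruncation.2 fun i =>
      Finset.single_le_sum (f := n.1) (fun _ _ => Nat.zero_le _) (Finset.mem_univ i)

theorem Converges.tendsto_hsum {w : List ℕ} (h : Converges w) :
    Tendsto (hsum w) atTop (𝓝 (zeta w)) :=
  (h.hasSum.comp (tendsto_decreasingTruncation _)).congr (sum_decreasingTruncation w)

theorem Converges.hsum_le_zeta {w : List ℕ} (h : Converges w) (N : ℕ) : hsum w N ≤ zeta w :=
  (hsum_mono w).ge_of_tendsto h.tendsto_hsum N

theorem converges_of_hsum_le {w : List ℕ} {B : ℝ} (h : ∀ N, hsum w N ≤ B) : Converges w := by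
  refine summable_of_sum_le (c := B) (fun n => term_nonneg w n.1) fun u => ?_
  obtain ⟨N, hN⟩ := ((tendsto_decreasingTruncation w.length).eventually_ge_atTop u).exists
  exact (Finset.sum_le_sum_of_subset_of_nonneg hN fun n _ _ => term_nonneg w n.1).trans
    ((sum_decreasingTruncation w N).trans_le (h N))

theorem gammaReg_eq {w : List ℕ} {c : ℝ} (h : IsFinitePart (hsum w) c) : gammaReg w = c := by
  rw [← harmonicSum_eq_hsum] at h
  have hex : ∃ c, IsFinitePart (harmonicSum w) c := ⟨c, h⟩
  rw [gammaReg, dif_pos hex]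
  exact hex.choose_spec.unique h

theorem Converges.gammaReg_eq_zeta {w : List ℕ} (h : Converges w) : gammaReg w = zeta w :=
  gammaReg_eq ⟨Polynomial.C (zeta w), by simp, by simpa using h.tendsto_hsum.sub_const (zeta w)⟩

theorem wordPow_singleton (r k : ℕ) : wordPow [r] k = List.replicate k r :=
  List.flatten_replicate_singleton

theorem wordPow_succ (w : List ℕ) (k : ℕ) : wordPow w (k + 1) = w ++ wordPow w k := by
  simp [wordPow, List.replicate_succ]

open Finset.HasAntidiagonal (antidiagonal mem_antidiagonal)

/-! ### Alternating convolutions -/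

section AltConv

variable {A B : Type*} [CommRing A] [CommRing B]

/-- The alternating convolution of two sequences: the coefficient of `T ^ m` in
`(∑ F a * T ^ a) * (∑ G b * (-T) ^ b)`. -/
def altConv (F G : ℕ → A) (m : ℕ) : A :=
  ∑ p ∈ antidiagonal m, (-1) ^ p.2 * F p.1 * G p.2

@[simp] theorem altConv_zero (F G : ℕ → A) : altConv F G 0 = F 0 * G 0 := by simp [altConv]

theorem altConv_succ_left (F G : ℕ → A) (m : ℕ) :
    altConv F G (m + 1) = (-1) ^ (m + 1) * F 0 * G (m + 1) + altConv (fun a => F (a + 1)) G m :=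
  Finset.Nat.sum_antidiagonal_succ

theorem altConv_succ_right (F G : ℕ → A) (m : ℕ) :
    altConv F G (m + 1) = F (m + 1) * G 0 - altConv F (fun b => G (b + 1)) m := by
  rw [altConv, Finset.Nat.sum_antidiagonal_succ', altConv, sub_eq_add_neg, ← Finset.sum_neg_distrib]
  congr 1
  · simp
  · exact Finset.sum_congr rfl fun p _ => by ring

theorem altConv_comm (F G : ℕ → A) (m : ℕ) : altConv G F m = (-1) ^ m * altConv F G m := by
  rw [altConv, ← Finset.Nat.sum_antidiagonal_swap, altConv, Finset.mul_sum]
  refine Finset.sum_congr rfl fun p hp => ?_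
  rw [← mem_antidiagonal.1 hp, pow_add, ← sub_eq_zero]
  have hsq : ((-1 : A) ^ p.2) * (-1) ^ p.2 = 1 := by rw [← mul_pow]; simp
  simp only [Prod.fst_swap, Prod.snd_swap]
  linear_combination (-(-1) ^ p.1 * G p.2 * F p.1) * hsq

theorem altConv_mul_left (x : A) (F G : ℕ → A) (m : ℕ) :
    altConv (fun a => x * F a) G m = x * altConv F G m := by
  simp only [altConv, Finset.mul_sum]
  exact Finset.sum_congr rfl fun p _ => by ring

theorem altConv_mul_right (x : A) (F G : ℕ → A) (m : ℕ) :
    altConv F (fun b => x * G b) m = x * altConv F G m := by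
  simp only [altConv, Finset.mul_sum]
  exact Finset.sum_congr rfl fun p _ => by ring

theorem map_altConv (φ : A →+* B) (F G : ℕ → A) (m : ℕ) :
    φ (altConv F G m) = altConv (fun a => φ (F a)) (fun b => φ (G b)) m := by
  simp [altConv, map_sum]

end AltConv

/-! ### Newton's identities for harmonic sums -/

theorem hsum_replicate_eq_esymm (r k N : ℕ) :
    hsum (List.replicate k r) N =
      ((Finset.range N).val.map fun j : ℕ => (((j + 1 : ℕ) : ℝ) ^ r)⁻¹).esymm k := by
  induction N generalizing k with
  | zero => cases k <;> simp [Multiset.esymm, List.replicate_succ, Multiset.powersetCard_zero_right]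
  | succ N ih =>
    cases k with
    | zero => simp [Multiset.esymm]
    | succ k =>
      rw [List.replicate_succ, hsum_cons_succ, ← List.replicate_succ, ih, ih]
      simp only [Finset.range_val, Multiset.range_succ, Multiset.map_cons, Multiset.esymm,
        Multiset.powersetCard_cons, Multiset.map_add, Multiset.map_map, Multiset.sum_add,
        Function.comp_def, Multiset.prod_cons, Multiset.sum_map_mul_left]

theorem aeval_esymm_eq_hsum (r k N : ℕ) :
    MvPolynomial.aeval (fun i : Fin N => (((i + 1 : ℕ) : ℝ) ^ r)⁻¹) (MvPolynomial.esymm (Fin N) ℝ k)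
      = hsum (List.replicate k r) N := by
  rw [MvPolynomial.aeval_esymm_eq_multiset_esymm, hsum_replicate_eq_esymm, ← Nat.Iio_eq_range,
    ← Fin.map_valEmbedding_univ, Finset.map_val, Multiset.map_map]
  rfl

theorem aeval_psum_eq_hsum (r b N : ℕ) :
    MvPolynomial.aeval (fun i : Fin N => (((i + 1 : ℕ) : ℝ) ^ r)⁻¹) (MvPolynomial.psum (Fin N) ℝ b)
      = hsum [r * b] N := by
  simp [MvPolynomial.psum, hsum_singleton, pow_mul, Finset.sum_range]

theorem sum_antidiagonal_succ_filter_fst_lt {M : Type*} [AddCommMonoid M] (k : ℕ)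
    (f : ℕ × ℕ → M) :
    ∑ p ∈ antidiagonal (k + 1) with p.1 < k + 1, f p = ∑ p ∈ antidiagonal k, f (p.1, p.2 + 1) := by
  rw [Finset.sum_filter, Finset.Nat.sum_antidiagonal_succ', if_neg (lt_irrefl _), zero_add]
  exact Finset.sum_congr rfl fun p hp =>
    if_pos (Nat.lt_succ_of_le (Finset.HasAntidiagonal.antidiagonal.fst_le hp))

/-- The sums `H_{{r}^k}(N)` are the elementary symmetric functions of the numbers `j ^ (-r)` with
`1 ≤ j ≤ N`, and the `H_{(rb)}(N)` are their power sums: this is Newton's identity. -/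
theorem succ_mul_hsum_replicate (r k N : ℕ) :
    ((k : ℝ) + 1) * hsum (List.replicate (k + 1) r) N =
      altConv (fun a => hsum (List.replicate a r) N) (fun b => hsum [r * (b + 1)] N) k := by
  have newton := congrArg (MvPolynomial.aeval fun i : Fin N => (((i + 1 : ℕ) : ℝ) ^ r)⁻¹)
    (MvPolynomial.mul_esymm_eq_sum (Fin N) ℝ (k + 1))
  simp only [sum_antidiagonal_succ_filter_fst_lt, map_mul, map_natCast, map_pow, map_neg, map_one,
    map_sum, aeval_esymm_eq_hsum, aeval_psum_eq_hsum] at newton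
  rw [← Nat.cast_succ, newton, Finset.mul_sum]
  refine Finset.sum_congr rfl fun p hp => ?_
  have hsign : (-1 : ℝ) ^ (k + 1 + 1) * (-1) ^ p.1 = (-1) ^ p.2 := by
    rw [← mem_antidiagonal.1 hp, ← pow_add,
      show p.1 + p.2 + 1 + 1 + p.1 = 2 * (p.1 + 1) + p.2 by ring, pow_add, pow_mul]
    simp
  rw [← hsign]
  ring

theorem prod_one_add_mul_eq_sum_hsum (r N : ℕ) (c : ℂ) :
    ∏ j ∈ Finset.range N, (1 + c * (((j + 1 : ℕ) : ℂ) ^ r)⁻¹) =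
      ∑ k ∈ Finset.range (N + 1), c ^ k * (hsum (List.replicate k r) N : ℂ) := by
  rw [Finset.prod_one_add, Finset.sum_powerset, Finset.card_range]
  refine Finset.sum_congr rfl fun k _ => ?_
  rw [hsum_replicate_eq_esymm, Finset.esymm_map_val, Complex.ofReal_sum, Finset.mul_sum]
  refine Finset.sum_congr rfl fun t ht => ?_
  rw [Finset.prod_mul_distrib, Finset.prod_const, (Finset.mem_powersetCard.1 ht).2]
  push_cast
  rfl

theorem hsum_replicate_eq_zero {r k N : ℕ} (h : N < k) : hsum (List.replicate k r) N = 0 := by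
  rw [hsum_replicate_eq_esymm, Finset.esymm_map_val,
    Finset.powersetCard_eq_empty.2 (by rwa [Finset.card_range]), Finset.sum_empty]

theorem hsum_singleton_le_add {m : ℕ} (hm : 2 ≤ m) {n N : ℕ} (hn : 1 ≤ n) (h : n ≤ N) :
    hsum [m] N ≤ hsum [m] n + ((n : ℝ)⁻¹ - (N : ℝ)⁻¹) := by
  induction N, h using Nat.le_induction with
  | base => simp
  | succ N hN ih =>
    have hN' : (0 : ℝ) < N := by exact_mod_cast hn.trans hN
    have hpow : (((N + 1 : ℕ) : ℝ) ^ m)⁻¹ ≤ (((N + 1 : ℕ) : ℝ) ^ 2)⁻¹ := by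
      gcongr
      exact_mod_cast N.succ_pos
    have htelescope : (((N + 1 : ℕ) : ℝ) ^ 2)⁻¹ ≤ (N : ℝ)⁻¹ - ((N + 1 : ℕ) : ℝ)⁻¹ := by
      push_cast
      rw [inv_sub_inv hN'.ne' (by positivity), add_sub_cancel_left, inv_eq_one_div]
      exact one_div_le_one_div_of_le (by positivity) (by nlinarith)
    rw [hsum_cons_succ, hsum_nil, mul_one]
    linarith

theorem hsum_singleton_le_two {m : ℕ} (hm : 2 ≤ m) (N : ℕ) : hsum [m] N ≤ 2 := by
  have h := hsum_singleton_le_add hm le_rfl (Nat.le_add_left 1 N)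
  have hone : hsum [m] 1 = 1 := by simp [hsum_singleton]
  have hinv : (0 : ℝ) ≤ ((N + 1 : ℕ) : ℝ)⁻¹ := by positivity
  rw [hone, Nat.cast_one, inv_one] at h
  linarith [hsum_mono [m] N.le_succ]

theorem pow_mul_hsum_replicate_le_exp {x : ℝ} (hx : 0 ≤ x) (r k N : ℕ) :
    x ^ k * hsum (List.replicate k r) N ≤ Real.exp (x * hsum [r] N) := by
  rcases lt_or_ge N k with hk | hk
  · rw [hsum_replicate_eq_zero hk, mul_zero]
    exact (Real.exp_pos _).le
  · calc x ^ k * hsum (List.replicate k r) N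
        ≤ ∑ k ∈ Finset.range (N + 1), x ^ k * hsum (List.replicate k r) N :=
          Finset.single_le_sum (f := fun k => x ^ k * hsum (List.replicate k r) N)
            (fun i _ => mul_nonneg (pow_nonneg hx i) (hsum_nonneg _ _))
            (Finset.mem_range.2 (Nat.lt_succ_of_le hk))
      _ = ∏ j ∈ Finset.range N, (1 + x * (((j + 1 : ℕ) : ℝ) ^ r)⁻¹) := by
          refine Complex.ofReal_injective ?_
          push_cast
          exact_mod_cast (prod_one_add_mul_eq_sum_hsum r N x).symm
      _ ≤ Real.exp (∑ j ∈ Finset.range N, x * (((j + 1 : ℕ) : ℝ) ^ r)⁻¹) :=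
          Real.prod_one_add_le_exp_sum _ fun _ => by positivity
      _ = Real.exp (x * hsum [r] N) := by rw [← Finset.mul_sum, hsum_singleton]

theorem converges_replicate {r : ℕ} (hr : 2 ≤ r) (k : ℕ) : Converges (List.replicate k r) :=
  converges_of_hsum_le (B := Real.exp 2) fun N => by
    have h := pow_mul_hsum_replicate_le_exp zero_le_one r k N
    rw [one_pow, one_mul, one_mul] at h
    exact h.trans (Real.exp_le_exp.2 (hsum_singleton_le_two hr N))

theorem norm_pow_mul_hsum_replicate_le {r : ℕ} (hr : 2 ≤ r) (c : ℂ) (k N : ℕ) :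
    ‖c ^ k * (hsum (List.replicate k r) N : ℂ)‖ ≤ Real.exp (2 * ‖c‖ * 2) * (1 / 2) ^ k := by
  have h := pow_mul_hsum_replicate_le_exp (by positivity : 0 ≤ 2 * ‖c‖) r k N
  have hexp : Real.exp (2 * ‖c‖ * hsum [r] N) ≤ Real.exp (2 * ‖c‖ * 2) := by
    gcongr
    exact hsum_singleton_le_two hr N
  rw [norm_mul, norm_pow, Complex.norm_of_nonneg (hsum_nonneg _ _), one_div, inv_pow,
    ← div_eq_mul_inv, le_div_iff₀ (by positivity)]
  calc ‖c‖ ^ k * hsum (List.replicate k r) N * 2 ^ k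
      = (2 * ‖c‖) ^ k * hsum (List.replicate k r) N := by ring
    _ ≤ Real.exp (2 * ‖c‖ * 2) := h.trans hexp

theorem tendsto_pow_mul_hsum_replicate {r : ℕ} (hr : 2 ≤ r) (c : ℂ) (k : ℕ) :
    Tendsto (fun N => c ^ k * (hsum (List.replicate k r) N : ℂ)) atTop
      (𝓝 (c ^ k * (zeta (wordPow [r] k) : ℂ))) := by
  rw [wordPow_singleton]
  exact ((Complex.continuous_ofReal.tendsto _).comp
    (converges_replicate hr k).tendsto_hsum).const_mul _

theorem starConverges_zeta {r : ℕ} (hr : 2 ≤ r) (c : ℂ) : StarConverges zeta c [r] :=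
  (summable_geometric_two.mul_left (Real.exp (2 * ‖c‖ * 2))).of_norm_bounded fun k =>
    le_of_tendsto' (tendsto_pow_mul_hsum_replicate hr c k).norm fun N =>
      norm_pow_mul_hsum_replicate_le hr c k N

theorem tendsto_prod_starValue_zeta {r : ℕ} (hr : 2 ≤ r) (c : ℂ) :
    Tendsto (fun N => ∏ j ∈ Finset.range N, (1 + c * (((j + 1 : ℕ) : ℂ) ^ r)⁻¹)) atTop
      (𝓝 (starValue zeta c [r])) := by
  have h := tendsto_tsum_of_dominated_convergence
    (summable_geometric_two.mul_left (Real.exp (2 * ‖c‖ * 2)))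
    (fun k => tendsto_pow_mul_hsum_replicate hr c k)
    (Eventually.of_forall fun N k => norm_pow_mul_hsum_replicate_le hr c k N)
  refine h.congr fun N => ?_
  rw [prod_one_add_mul_eq_sum_hsum]
  refine tsum_eq_sum fun k hk => ?_
  rw [Finset.mem_range, not_lt] at hk
  rw [hsum_replicate_eq_zero hk, Complex.ofReal_zero, mul_zero]

/-! ### Finite parts -/

/-- `u n = P (log n) + o((log n) ^ (-m))` for every `m`. Unlike the plain `o(1)` of
`IsFinitePart`, this error term survives multiplication by polynomials in `log n`, so such
expansions can be multiplied. -/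
def IsLogAsymptotic (u : ℕ → ℝ) (P : Polynomial ℝ) : Prop :=
  Asymptotics.SuperpolynomialDecay atTop (fun n : ℕ => Real.log n)
    (fun n : ℕ => u n - P.eval (Real.log n))

namespace IsLogAsymptotic

variable {u v : ℕ → ℝ} {P Q : Polynomial ℝ}

theorem isFinitePart (h : IsLogAsymptotic u P) : IsFinitePart u (P.coeff 0) :=
  ⟨P, rfl, by simpa only [pow_zero, one_mul] using h 0⟩

theorem const (c : ℝ) : IsLogAsymptotic (fun _ => c) (Polynomial.C c) :=
  (Asymptotics.superpolynomialDecay_zero _ _).congr fun n => by simp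

theorem add (hu : IsLogAsymptotic u P) (hv : IsLogAsymptotic v Q) :
    IsLogAsymptotic (fun n => u n + v n) (P + Q) :=
  (Asymptotics.SuperpolynomialDecay.add hu hv).congr fun n => by
    simp only [Pi.add_apply, Polynomial.eval_add]
    ring

theorem mul (hu : IsLogAsymptotic u P) (hv : IsLogAsymptotic v Q) :
    IsLogAsymptotic (fun n => u n * v n) (P * Q) :=
  (((Asymptotics.SuperpolynomialDecay.polynomial_mul hu Q).add
    (Asymptotics.SuperpolynomialDecay.polynomial_mul hv P)).add
      (Asymptotics.SuperpolynomialDecay.mul hu hv)).congr fun n => by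
    simp only [Pi.add_apply, Pi.mul_apply, Polynomial.eval_mul]
    ring

theorem sum {ι : Type*} (s : Finset ι) {u : ι → ℕ → ℝ} {P : ι → Polynomial ℝ}
    (h : ∀ i ∈ s, IsLogAsymptotic (u i) (P i)) :
    IsLogAsymptotic (fun n => ∑ i ∈ s, u i n) (∑ i ∈ s, P i) := by
  classical
  induction s using Finset.induction_on with
  | empty => simpa using const 0
  | insert i s hi ih =>
    simp only [Finset.sum_insert hi]
    exact (h i (Finset.mem_insert_self i s)).add
      (ih fun j hj => h j (Finset.mem_insert_of_mem hj))

theorem altConv {u v : ℕ → ℕ → ℝ} {P Q : ℕ → Polynomial ℝ} {k : ℕ}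
    (hu : ∀ a ≤ k, IsLogAsymptotic (u a) (P a)) (hv : ∀ b ≤ k, IsLogAsymptotic (v b) (Q b)) :
    IsLogAsymptotic (fun n => altConv (fun a => u a n) (fun b => v b n) k) (altConv P Q k) :=
  IsLogAsymptotic.sum _ fun p hp => by
    have hsign : (-1 : Polynomial ℝ) ^ p.2 = Polynomial.C ((-1) ^ p.2) := by simp
    rw [hsign]
    exact ((const _).mul (hu _ (Finset.HasAntidiagonal.antidiagonal.fst_le hp))).mul
      (hv _ (Finset.HasAntidiagonal.antidiagonal.snd_le hp))

theorem of_abs_sub_le_inv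
    (h : ∀ n : ℕ, 1 ≤ n → |u n - P.eval (Real.log n)| ≤ (n : ℝ)⁻¹) : IsLogAsymptotic u P := by
  intro m
  have hlog : Tendsto (fun n : ℕ => Real.log n ^ m / n) atTop (𝓝 0) :=
    (Real.isLittleO_pow_log_id_atTop (n := m)).tendsto_div_nhds_zero.comp
      tendsto_natCast_atTop_atTop
  refine squeeze_zero_norm' ?_ hlog
  filter_upwards [eventually_ge_atTop 1] with n hn
  have hlog_pow_nonneg : 0 ≤ Real.log n ^ m := pow_nonneg (Real.log_natCast_nonneg n) m
  rw [norm_mul, Real.norm_of_nonneg hlog_pow_nonneg, Real.norm_eq_abs, div_eq_mul_inv]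
  exact mul_le_mul_of_nonneg_left (h n hn) hlog_pow_nonneg

theorem gammaReg_eq {w : List ℕ} (h : IsLogAsymptotic (hsum w) P) : gammaReg w = P.coeff 0 :=
  Polyzeta.gammaReg_eq h.isFinitePart

end IsLogAsymptotic

theorem isLogAsymptotic_hsum_one :
    IsLogAsymptotic (hsum [1]) (Polynomial.X + Polynomial.C Real.eulerMascheroniConstant) := by
  refine IsLogAsymptotic.of_abs_sub_le_inv fun n hn => ?_
  have hpos : (0 : ℝ) < n := by exact_mod_cast hn
  have hharmonic : hsum [1] n = harmonic n := by simp [hsum_singleton, harmonic]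
  have hlower := Real.eulerMascheroniSeq_lt_eulerMascheroniConstant n
  have hupper := Real.eulerMascheroniConstant_lt_eulerMascheroniSeq' n
  rw [Real.eulerMascheroniSeq] at hlower
  rw [Real.eulerMascheroniSeq', if_neg (by omega)] at hupper
  have hlog : Real.log (n + 1) - Real.log n ≤ (n : ℝ)⁻¹ := by
    rw [← Real.log_div (by positivity) hpos.ne', add_div, div_self hpos.ne', one_div]
    linarith [Real.log_le_sub_one_of_pos (by positivity : 0 < 1 + (n : ℝ)⁻¹)]
  rw [hharmonic, Polynomial.eval_add, Polynomial.eval_X, Polynomial.eval_C, abs_le]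
  constructor <;> linarith

theorem isLogAsymptotic_hsum_singleton {m : ℕ} (hm : 2 ≤ m) :
    IsLogAsymptotic (hsum [m]) (Polynomial.C (zeta [m])) := by
  have hconv : Converges [m] := converges_replicate hm 1
  refine IsLogAsymptotic.of_abs_sub_le_inv fun n hn => ?_
  have htail : zeta [m] ≤ hsum [m] n + (n : ℝ)⁻¹ := by
    refine le_of_tendsto hconv.tendsto_hsum ?_
    filter_upwards [eventually_ge_atTop n] with N hN
    have hinv : (0 : ℝ) ≤ (N : ℝ)⁻¹ := by positivity
    linarith [hsum_singleton_le_add hm hn hN]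
  rw [Polynomial.eval_C, abs_le]
  constructor <;> linarith [hconv.hsum_le_zeta n]

theorem exists_isLogAsymptotic_hsum_singleton {m : ℕ} (hm : 1 ≤ m) :
    ∃ P, IsLogAsymptotic (hsum [m]) P := by
  rcases hm.eq_or_lt with rfl | hm
  · exact ⟨_, isLogAsymptotic_hsum_one⟩
  · exact ⟨_, isLogAsymptotic_hsum_singleton hm⟩

theorem exists_isLogAsymptotic_hsum_replicate {r : ℕ} (hr : 1 ≤ r) (k : ℕ) :
    ∃ P, IsLogAsymptotic (hsum (List.replicate k r)) P := by
  induction k using Nat.strong_induction_on with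
  | _ k ih =>
    cases k with
    | zero => exact ⟨_, IsLogAsymptotic.const 1⟩
    | succ k =>
      choose! P hP using ih
      choose Q hQ using fun b : ℕ =>
        exists_isLogAsymptotic_hsum_singleton (m := r * (b + 1)) (Nat.mul_pos hr b.succ_pos)
      have h := (IsLogAsymptotic.const ((k : ℝ) + 1)⁻¹).mul
        (IsLogAsymptotic.altConv (fun a ha => hP a (Nat.lt_succ_of_le ha)) fun b _ => hQ b)
      have hk : (k : ℝ) + 1 ≠ 0 := Nat.cast_add_one_ne_zero k
      simp only [← succ_mul_hsum_replicate, inv_mul_cancel_left₀ hk] at h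
      exact ⟨_, h⟩

theorem isFinitePart_gammaReg_replicate {r : ℕ} (hr : 1 ≤ r) (k : ℕ) :
    IsFinitePart (hsum (List.replicate k r)) (gammaReg (List.replicate k r)) := by
  obtain ⟨P, hP⟩ := exists_isLogAsymptotic_hsum_replicate hr k
  rw [hP.gammaReg_eq]
  exact hP.isFinitePart

theorem gammaReg_nil : gammaReg [] = 1 := by
  have h : IsLogAsymptotic (hsum []) (Polynomial.C 1) := IsLogAsymptotic.const 1
  rw [h.gammaReg_eq, Polynomial.coeff_C_zero]

theorem gammaReg_one : gammaReg [1] = Real.eulerMascheroniConstant := by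
  simp [isLogAsymptotic_hsum_one.gammaReg_eq]

/-- Newton's identity passes to the finite parts, because taking the constant term of the
expansion in `log n` is multiplicative. -/
theorem succ_mul_gammaReg_replicate {r : ℕ} (hr : 1 ≤ r) (k : ℕ) :
    ((k : ℝ) + 1) * gammaReg (List.replicate (k + 1) r) =
      altConv (fun a => gammaReg (List.replicate a r)) (fun b => gammaReg [r * (b + 1)]) k := by
  choose P hP using exists_isLogAsymptotic_hsum_replicate hr
  choose Q hQ using fun b : ℕ =>
    exists_isLogAsymptotic_hsum_singleton (m := r * (b + 1)) (Nat.mul_pos hr b.succ_pos)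
  have hleft := ((IsLogAsymptotic.const ((k : ℝ) + 1)).mul (hP (k + 1))).isFinitePart
  simp only [succ_mul_hsum_replicate] at hleft
  have hright := (IsLogAsymptotic.altConv (k := k) (fun a _ => hP a) fun b _ => hQ b).isFinitePart
  have h := hleft.unique hright
  simp only [← Polynomial.constantCoeff_apply, map_altConv, map_mul] at h
  simpa only [Polynomial.constantCoeff_apply, Polynomial.coeff_C_zero, ← (hP _).gammaReg_eq,
    ← (hQ _).gammaReg_eq] using h

theorem abs_gammaReg_singleton_le_two {m : ℕ} (hm : 1 ≤ m) : |gammaReg [m]| ≤ 2 := by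
  rcases hm.eq_or_lt with rfl | hm
  · rw [gammaReg_one, abs_le]
    constructor <;> linarith [Real.one_half_lt_eulerMascheroniConstant,
      Real.eulerMascheroniConstant_lt_two_thirds]
  · have hconv : Converges [m] := converges_replicate hm 1
    rw [hconv.gammaReg_eq_zeta, abs_of_nonneg ((hsum_nonneg _ 0).trans (hconv.hsum_le_zeta 0))]
    exact le_of_tendsto' hconv.tendsto_hsum (hsum_singleton_le_two hm)

theorem gammaReg_singleton_eq_riemannZeta {m : ℕ} (hm : 2 ≤ m) :
    (gammaReg [m] : ℂ) = riemannZeta m := by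
  have hconv : Converges [m] := converges_replicate hm 1
  have hsummable : Summable fun n : ℕ => 1 / ((n + 1 : ℕ) : ℝ) ^ m :=
    (summable_nat_add_iff 1).2 (Real.summable_one_div_nat_pow.2 hm)
  have hzeta : zeta [m] = ∑' n : ℕ, 1 / ((n + 1 : ℕ) : ℝ) ^ m := by
    refine tendsto_nhds_unique hconv.tendsto_hsum <|
      hsummable.hasSum.tendsto_sum_nat.congr fun N => ?_
    simp only [hsum_singleton, one_div]
  rw [hconv.gammaReg_eq_zeta, hzeta, zeta_nat_eq_tsum_of_gt_one hm, Complex.ofReal_tsum,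
    tsum_eq_zero_add' (f := fun n : ℕ => 1 / (n : ℂ) ^ m)
      ((Complex.summable_ofReal.2 hsummable).congr fun n => by push_cast; rfl)]
  simp [Nat.ne_zero_of_lt hm]

/-! ### Generating functions -/

/-- The coefficient of `z ^ n` in the Taylor expansion of `f` at `0`. -/
def taylorCoeff (f : ℂ → ℂ) (n : ℕ) : ℂ := iteratedDeriv n f 0 / (n.factorial : ℂ)

section TaylorCoeff

variable {f g : ℂ → ℂ}

@[simp] theorem taylorCoeff_zero (f : ℂ → ℂ) : taylorCoeff f 0 = f 0 := by simp [taylorCoeff]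

theorem taylorCoeff_congr (h : f =ᶠ[𝓝 0] g) : taylorCoeff f = taylorCoeff g :=
  funext fun n => by rw [taylorCoeff, h.iteratedDeriv_eq, taylorCoeff]

theorem succ_mul_taylorCoeff_succ (f : ℂ → ℂ) (n : ℕ) :
    ((n : ℂ) + 1) * taylorCoeff f (n + 1) = taylorCoeff (deriv f) n := by
  have hfac : (n.factorial : ℂ) ≠ 0 := Nat.cast_ne_zero.2 n.factorial_ne_zero
  have hsucc : (n : ℂ) + 1 ≠ 0 := Nat.cast_add_one_ne_zero n
  rw [taylorCoeff, taylorCoeff, iteratedDeriv_succ', Nat.factorial_succ]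
  push_cast
  field_simp

theorem taylorCoeff_mul (hf : AnalyticAt ℂ f 0) (hg : AnalyticAt ℂ g 0) (n : ℕ) :
    taylorCoeff (fun z => f z * g z) n =
      ∑ p ∈ antidiagonal n, taylorCoeff f p.1 * taylorCoeff g p.2 := by
  rw [taylorCoeff, iteratedDeriv_fun_mul hf.contDiffAt hg.contDiffAt,
    Finset.Nat.sum_antidiagonal_eq_sum_range_succ fun i j => taylorCoeff f i * taylorCoeff g j,
    Finset.sum_div]
  refine Finset.sum_congr rfl fun i hi => ?_
  have hfac : (n.factorial : ℂ) ≠ 0 := Nat.cast_ne_zero.2 n.factorial_ne_zero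
  rw [Nat.cast_choose ℂ (Finset.mem_range_succ_iff.1 hi), taylorCoeff, taylorCoeff]
  field_simp

theorem hasFPowerSeriesAt_ofScalars {a : ℕ → ℂ}
    (h : ∀ᶠ z in 𝓝 0, HasSum (fun k => z ^ k * a k) (f z)) :
    HasFPowerSeriesAt f (FormalMultilinearSeries.ofScalars ℂ a) 0 := by
  rw [hasFPowerSeriesAt_iff]
  simpa only [zero_add, smul_eq_mul, FormalMultilinearSeries.coeff_ofScalars] using h

theorem taylorCoeff_eq_of_hasSum {a : ℕ → ℂ}
    (h : ∀ᶠ z in 𝓝 0, HasSum (fun k => z ^ k * a k) (f z)) : taylorCoeff f = a := by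
  have hf := hasFPowerSeriesAt_ofScalars h
  have heq := hf.analyticAt.hasFPowerSeriesAt.eq_formalMultilinearSeries hf
  funext n
  simpa only [taylorCoeff, FormalMultilinearSeries.coeff_ofScalars] using
    congrArg (fun p => p.coeff n) heq

theorem hasSum_taylorCoeff {R : ℝ} (hf : DifferentiableOn ℂ f (Metric.ball 0 R)) {z : ℂ}
    (hz : ‖z‖ < R) : HasSum (fun k => z ^ k * taylorCoeff f k) (f z) := by
  refine (Complex.hasSum_taylorSeries_on_ball hf (mem_ball_zero_iff.2 hz)).congr_fun fun k => ?_
  rw [taylorCoeff, sub_zero, smul_eq_mul, smul_eq_mul]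
  ring

end TaylorCoeff

theorem differentiableOn_tsum_pow_mul {s : ℕ → ℂ} {R : ℝ}
    (hs : ∀ z : ℂ, ‖z‖ < R → Summable fun k => z ^ k * s k) :
    DifferentiableOn ℂ (fun z => ∑' k, z ^ k * s k) (Metric.ball 0 R) := by
  rcases le_or_gt R 0 with hR | hR
  · rw [Metric.ball_eq_empty.2 hR]
    exact differentiableOn_empty
  have hradius : ENNReal.ofReal R ≤ (FormalMultilinearSeries.ofScalars ℂ s).radius := by
    refine ENNReal.le_of_forall_nnreal_lt fun ρ hρ => ?_
    refine FormalMultilinearSeries.le_radius_of_tendsto _ (l := 0) ?_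
    have hnorm : ‖((ρ : ℝ) : ℂ)‖ = ρ := Complex.norm_of_nonneg ρ.2
    have h := (hs (ρ : ℝ) (by rwa [hnorm, ← ENNReal.ofReal_lt_ofReal_iff hR,
      ENNReal.ofReal_coe_nnreal])).tendsto_atTop_zero.norm
    simpa [mul_comm] using h
  have hpos := (ENNReal.ofReal_pos.2 hR).trans_le hradius
  have hdiff := (FormalMultilinearSeries.hasFPowerSeriesOnBall _ hpos).differentiableOn
  rw [← Metric.eball_ofReal]
  refine (hdiff.mono (Metric.eball_subset_eball hradius)).congr fun z _ => ?_
  simp [FormalMultilinearSeries.sum, mul_comm]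

theorem eq_of_recurrence {K : Type*} [Field K] [CharZero K] {a b s : ℕ → K} (h0 : a 0 = b 0)
    (ha : ∀ k : ℕ, ((k : K) + 1) * a (k + 1) = ∑ p ∈ antidiagonal k, a p.1 * s p.2)
    (hb : ∀ k : ℕ, ((k : K) + 1) * b (k + 1) = ∑ p ∈ antidiagonal k, b p.1 * s p.2) : a = b := by
  funext k
  induction k using Nat.strong_induction_on with
  | _ k ih =>
    cases k with
    | zero => exact h0
    | succ k =>
      refine mul_left_cancel₀ (Nat.cast_add_one_ne_zero k : (k : K) + 1 ≠ 0) ?_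
      rw [ha, hb]
      exact Finset.sum_congr rfl fun p hp => by
        rw [ih _ (Nat.lt_succ_of_le (Finset.HasAntidiagonal.antidiagonal.fst_le hp))]

/-- The recurrence says that the generating function `A` of `a` solves `A' = A * S`, where `S` is
that of `s`. -/
theorem exists_hasSum_exp_of_recurrence {a s : ℕ → ℂ} {R : ℝ} (ha0 : a 0 = 1)
    (ha : ∀ k : ℕ, ((k : ℂ) + 1) * a (k + 1) = ∑ p ∈ antidiagonal k, a p.1 * s p.2)
    (hs : ∀ z : ℂ, ‖z‖ < R → Summable fun k => z ^ k * s k) {z : ℂ} (hz : ‖z‖ < R) :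
    ∃ L, HasSum (fun k : ℕ => z ^ (k + 1) * (s k / ((k : ℂ) + 1))) L ∧
      HasSum (fun k => z ^ k * a k) (Complex.exp L) := by
  set S : ℂ → ℂ := fun z => ∑' k, z ^ k * s k
  have hS : DifferentiableOn ℂ S (Metric.ball 0 R) := differentiableOn_tsum_pow_mul hs
  have hball : Metric.ball (0 : ℂ) R ∈ 𝓝 0 := Metric.ball_mem_nhds 0 ((norm_nonneg z).trans_lt hz)
  have hSs : taylorCoeff S = s := taylorCoeff_eq_of_hasSum <| by
    filter_upwards [hball] with w hw using (hs w (mem_ball_zero_iff.1 hw)).hasSum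
  obtain ⟨G, hG0, hG⟩ := hS.isExactOn_ball.with_val_at 0 0
  have hGdiff : DifferentiableOn ℂ G (Metric.ball 0 R) := fun w hw =>
    (hG w hw).differentiableAt.differentiableWithinAt
  have hGs (k : ℕ) : taylorCoeff G (k + 1) = s k / ((k : ℂ) + 1) := by
    have hderiv : deriv G =ᶠ[𝓝 0] S := by filter_upwards [hball] with w hw using (hG w hw).deriv
    rw [eq_div_iff (Nat.cast_add_one_ne_zero k), mul_comm, succ_mul_taylorCoeff_succ,
      taylorCoeff_congr hderiv, hSs]
  set F : ℂ → ℂ := fun w => Complex.exp (G w)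
  have hFdiff : DifferentiableOn ℂ F (Metric.ball 0 R) := hGdiff.cexp
  have hFa : taylorCoeff F = a := by
    refine eq_of_recurrence (by simp [F, hG0, ha0]) (fun k => ?_) ha
    have hderiv : deriv F =ᶠ[𝓝 0] fun w => F w * S w := by
      filter_upwards [hball] with w hw using (hG w hw).cexp.deriv
    rw [succ_mul_taylorCoeff_succ, taylorCoeff_congr hderiv,
      taylorCoeff_mul (hFdiff.analyticAt hball) (hS.analyticAt hball), hSs]
  refine ⟨G z, ?_, hFa ▸ hasSum_taylorCoeff hFdiff hz⟩
  have h := (hasSum_nat_add_iff' 1).2 (hasSum_taylorCoeff hGdiff hz)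
  simpa [hGs, hG0] using h

/-! ### The functions `ℓ_r` -/

/-- `ellSeries r c` is `ℓ_r(z)` as a function of `c = z ^ r`, written with the values
`γ_{y_m} = ζ(m)` for `m ≥ 2` and `γ_{y_1} = γ` so that `r = 1` needs no separate treatment. -/
def ellSeries (r : ℕ) (c : ℂ) : ℂ :=
  ∑' k : ℕ, c ^ (k + 1) * ((-1) ^ k * (gammaReg [r * (k + 1)] : ℂ) / ((k : ℂ) + 1))

theorem norm_pow_lt_one {𝕜 : Type*} [NormedDivisionRing 𝕜] {z : 𝕜} (hz : ‖z‖ < 1)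
    {n : ℕ} (hn : n ≠ 0) : ‖z ^ n‖ < 1 := by
  rw [norm_pow]
  exact pow_lt_one₀ (norm_nonneg z) hz hn

theorem norm_neg_pow_lt_one {𝕜 : Type*} [NormedDivisionRing 𝕜] {z : 𝕜} (hz : ‖z‖ < 1)
    {n : ℕ} (hn : n ≠ 0) : ‖-z ^ n‖ < 1 :=
  (norm_neg _).trans_lt (norm_pow_lt_one hz hn)

section EllSeries

variable {r : ℕ} {c : ℂ}

theorem summable_pow_mul_gammaReg_singleton (hr : 1 ≤ r) (hc : ‖c‖ < 1) :
    Summable fun k : ℕ => c ^ k * ((-1) ^ k * (gammaReg [r * (k + 1)] : ℂ)) := by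
  refine ((summable_geometric_of_lt_one (norm_nonneg c) hc).mul_right 2).of_norm_bounded fun k => ?_
  rw [norm_mul, norm_mul, norm_pow, norm_pow, norm_neg, norm_one, one_pow, one_mul,
    Complex.norm_real]
  exact mul_le_mul_of_nonneg_left (abs_gammaReg_singleton_le_two (Nat.mul_pos hr k.succ_pos))
    (by positivity)

theorem hasSum_ellSeries_and_hasSum_exp_ellSeries (hr : 1 ≤ r) (hc : ‖c‖ < 1) :
    HasSum (fun k : ℕ => c ^ (k + 1) * ((-1) ^ k * (gammaReg [r * (k + 1)] : ℂ) / ((k : ℂ) + 1)))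
        (ellSeries r c) ∧
      HasSum (fun k => c ^ k * (gammaReg (wordPow [r] k) : ℂ)) (Complex.exp (ellSeries r c)) := by
  have hrec (k : ℕ) : ((k : ℂ) + 1) * (gammaReg (List.replicate (k + 1) r) : ℂ) =
      ∑ p ∈ antidiagonal k, (gammaReg (List.replicate p.1 r) : ℂ) *
        ((-1) ^ p.2 * (gammaReg [r * (p.2 + 1)] : ℂ)) := by
    have h := congrArg Complex.ofReal (succ_mul_gammaReg_replicate hr k)
    rw [altConv] at h
    push_cast at h
    rw [h]
    exact Finset.sum_congr rfl fun p _ => by ring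
  obtain ⟨L, hL, hexp⟩ := exists_hasSum_exp_of_recurrence
    (a := fun k => (gammaReg (List.replicate k r) : ℂ)) (by simp [gammaReg_nil]) hrec
    (fun z hz => summable_pow_mul_gammaReg_singleton hr hz) hc
  rw [ellSeries, hL.tsum_eq]
  simp only [wordPow_singleton]
  exact ⟨hL, hexp⟩

theorem hasSum_ellSeries (hr : 1 ≤ r) (hc : ‖c‖ < 1) :
    HasSum (fun k : ℕ => c ^ (k + 1) * ((-1) ^ k * (gammaReg [r * (k + 1)] : ℂ) / ((k : ℂ) + 1)))
      (ellSeries r c) :=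
  (hasSum_ellSeries_and_hasSum_exp_ellSeries hr hc).1

theorem starConverges_gammaReg (hr : 1 ≤ r) (hc : ‖c‖ < 1) : StarConverges gammaReg c [r] :=
  (hasSum_ellSeries_and_hasSum_exp_ellSeries hr hc).2.summable

theorem starValue_gammaReg_eq_exp (hr : 1 ≤ r) (hc : ‖c‖ < 1) :
    starValue gammaReg c [r] = Complex.exp (ellSeries r c) :=
  (hasSum_ellSeries_and_hasSum_exp_ellSeries hr hc).2.tsum_eq

theorem starValue_gammaReg_eq_zeta (hr : 2 ≤ r) (c : ℂ) :
    starValue gammaReg c [r] = starValue zeta c [r] :=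
  tsum_congr fun k => by rw [wordPow_singleton, (converges_replicate hr k).gammaReg_eq_zeta]

/-- Only the terms with odd `k` survive in the sum. -/
theorem ellSeries_add_ellSeries_neg (hr : 1 ≤ r) (hc : ‖c‖ < 1) :
    ellSeries r c + ellSeries r (-c) = ellSeries (2 * r) (-c ^ 2) := by
  have hc2 := norm_neg_pow_lt_one hc two_ne_zero
  have hadd := (hasSum_ellSeries hr hc).add (hasSum_ellSeries hr ((norm_neg c).trans_lt hc))
  have hodd := hasSum_ellSeries (Nat.mul_pos two_pos hr) hc2
  have hinj : Function.Injective fun j : ℕ => 2 * j + 1 := fun i j h => by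
    simpa using h
  refine hadd.unique ((hinj.hasSum_iff fun k hk => ?_).1 (hodd.congr_fun fun j => ?_))
  · obtain ⟨j, rfl⟩ : Even k := by
      rw [← Nat.not_odd_iff_even]
      exact fun ⟨j, hj⟩ => hk ⟨j, hj.symm⟩
    rw [(Odd.neg_pow ⟨j, by ring⟩ c : (-c) ^ (j + j + 1) = -c ^ (j + j + 1))]
    ring
  · have hj : (j : ℂ) + 1 ≠ 0 := Nat.cast_add_one_ne_zero j
    have hj2 : 2 * (j : ℂ) + 1 + 1 = 2 * (j + 1) := by ring
    have hindex : 2 * r * (j + 1) = r * (2 * j + 1 + 1) := by ring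
    have hneg : (-c) ^ (2 * j + 1 + 1) = c ^ (2 * j + 1 + 1) := Even.neg_pow ⟨j + 1, by ring⟩ c
    have hsign : (-1 : ℂ) ^ (2 * j + 1) = -1 := Odd.neg_one_pow ⟨j, rfl⟩
    have hsign_sq : ((-1 : ℂ) ^ j) * (-1) ^ j = 1 := by rw [← mul_pow]; simp
    simp only [Function.comp_apply, hindex, hneg, hsign, neg_pow (c ^ 2), ← pow_mul]
    push_cast
    rw [hj2]
    field_simp
    linear_combination 2 * c ^ (2 * (j + 1)) * gammaReg [r * (2 * j + 1 + 1)] * hsign_sq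

theorem starValue_gammaReg_neg_sq (hr : 1 ≤ r) (hc : ‖c‖ < 1) :
    starValue gammaReg (-c ^ 2) [2 * r] =
      starValue gammaReg c [r] * starValue gammaReg (-c) [r] := by
  have hc2 := norm_neg_pow_lt_one hc two_ne_zero
  rw [starValue_gammaReg_eq_exp (Nat.mul_pos two_pos hr) hc2, starValue_gammaReg_eq_exp hr hc,
    starValue_gammaReg_eq_exp hr ((norm_neg c).trans_lt hc), ← Complex.exp_add,
    ellSeries_add_ellSeries_neg hr hc]

theorem hasSum_riemannZeta_mul_pow (hr : 2 ≤ r) {t : ℂ} (ht : ‖t‖ < 1) :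
    HasSum (fun k : ℕ => riemannZeta ((r * (k + 1) : ℕ) : ℂ) * t ^ (r * (k + 1)) /
      ((k + 1 : ℕ) : ℂ)) (-ellSeries r (-t ^ r)) := by
  have hpow := norm_neg_pow_lt_one ht (n := r) (by omega)
  refine (hasSum_ellSeries (by omega) hpow).neg.congr_fun fun k => ?_
  have hsign : ((-1 : ℂ) ^ k) * (-1) ^ k = 1 := by rw [← mul_pow]; simp
  rw [← gammaReg_singleton_eq_riemannZeta (hr.trans (Nat.le_mul_of_pos_right r k.succ_pos)),
    neg_pow, ← pow_mul]
  push_cast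
  linear_combination -t ^ (r * (k + 1)) * gammaReg [r * (k + 1)] / (k + 1) * hsign

theorem ell_eq_ellSeries (hr : 1 ≤ r) {z : ℂ} (hz : ‖z‖ < 1) : ell r z = ellSeries r (z ^ r) := by
  rcases hr.eq_or_lt with rfl | hr
  · have hsum := (hasSum_ellSeries le_rfl hz).summable
    rw [ell, if_pos rfl, pow_one, ellSeries, hsum.tsum_eq_zero_add, sub_eq_add_neg, ← tsum_neg]
    congr 1
    · simp [gammaReg_one, mul_comm]
    · refine tsum_congr fun k => ?_
      rw [one_mul, gammaReg_singleton_eq_riemannZeta (by omega), neg_pow z]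
      push_cast
      ring_nf
  · rw [ell, if_neg hr.ne', ellSeries, ← tsum_neg]
    refine tsum_congr fun k => ?_
    rw [gammaReg_singleton_eq_riemannZeta (hr.trans_le (Nat.le_mul_of_pos_right r k.succ_pos)),
      mul_comm (k + 1) r, neg_pow (z ^ r)]
    push_cast
    ring

theorem inv_GammaY_one_add (hr : 1 ≤ r) {z : ℂ} (hz : ‖z‖ < 1) :
    (GammaY r (1 + z))⁻¹ = starValue gammaReg (z ^ r) [r] := by
  rw [GammaY, ← Complex.exp_neg, neg_neg, add_sub_cancel_left, ell_eq_ellSeries hr hz,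
    starValue_gammaReg_eq_exp hr (norm_pow_lt_one hz (by omega))]

end EllSeries

/-! ### Polylogarithms and the shuffle identity -/

section ShuffleEquations

variable {R A : Type*} [CommRing R] [CommRing A] [Algebra R A] (D : Derivation R A A)

theorem derivation_altConv (F G : ℕ → A) (m : ℕ) :
    D (altConv F G m) = altConv (fun a => D (F a)) G m + altConv F (fun b => D (G b)) m := by
  have hsign (n : ℕ) : D ((-1) ^ n) = 0 := by simp [Derivation.leibniz_pow]
  simp only [altConv, map_sum, Derivation.leibniz, hsign, smul_eq_mul, ← Finset.sum_add_distrib]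
  exact Finset.sum_congr rfl fun p _ => by ring

variable {D} {x y : A} {L M : ℕ → A}

theorem mul_altConv_derivation_left (hL₀ : D (L 0) = 0) (hL : ∀ k, x * D (L (k + 1)) = M k)
    (G : ℕ → A) (m : ℕ) : x * altConv (fun a => D (L a)) G (m + 1) = altConv M G m := by
  rw [altConv_succ_left, hL₀, mul_zero, zero_mul, zero_add, ← altConv_mul_left]
  simp only [hL]

theorem mul_altConv_derivation_right (hL₀ : D (L 0) = 0) (hL : ∀ k, x * D (L (k + 1)) = M k)
    (G : ℕ → A) (m : ℕ) : x * altConv G (fun b => D (L b)) (m + 1) = -altConv G M m := by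
  rw [altConv_succ_right, hL₀, mul_zero, zero_sub, mul_neg, ← altConv_mul_right]
  simp only [hL]

theorem mul_derivation_altConv_self (hL₀ : D (L 0) = 0) (hL : ∀ k, x * D (L (k + 1)) = M k)
    (m : ℕ) : x * D (altConv L L (m + 1)) = altConv M L m - altConv L M m := by
  rw [derivation_altConv, mul_add, mul_altConv_derivation_left hL₀ hL,
    mul_altConv_derivation_right hL₀ hL, sub_eq_add_neg]

theorem mul_derivation_altConv_shifted (hM : ∀ k, y * D (M k) = L k) (m : ℕ) :
    y * D (altConv M M m) = altConv L M m + altConv M L m := by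
  rw [derivation_altConv, mul_add, ← altConv_mul_left, ← altConv_mul_right]
  simp only [hM]

variable [IsDomain A]

theorem mul_derivation_altConv_sub (hL₀ : D (L 0) = 0) (hL : ∀ k, x * D (L (k + 1)) = M k)
    (hy : y ≠ 0) (hM : ∀ k, y * D (M k) = L k) (m : ℕ) :
    x * D (altConv M L (m + 1) - altConv L M (m + 1)) = -2 * altConv M M m := by
  have hcancel : altConv (fun a => D (M a)) L (m + 1) = altConv L (fun b => D (M b)) (m + 1) := by
    refine mul_left_cancel₀ hy ?_
    rw [← altConv_mul_left, ← altConv_mul_right]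
    simp only [hM]
  rw [map_sub, derivation_altConv, derivation_altConv, hcancel]
  linear_combination
    mul_altConv_derivation_right hL₀ hL M m - mul_altConv_derivation_left hL₀ hL M m

theorem mul_derivation_altConv_add (hx : x ≠ 0) (hL₀ : D (L 0) = 0)
    (hL : ∀ k, x * D (L (k + 1)) = M k) (hM : ∀ k, y * D (M k) = L k) (m : ℕ) :
    y * D (altConv L M m + altConv M L m) = 2 * altConv L L m := by
  have hcancel : altConv (fun a => D (L a)) M m + altConv M (fun b => D (L b)) m = 0 := by
    cases m with
    | zero => simp [hL₀]
    | succ m =>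
      refine (mul_eq_zero_iff_left hx).1 ?_
      rw [mul_add, mul_altConv_derivation_left hL₀ hL, mul_altConv_derivation_right hL₀ hL,
        add_neg_cancel]
  have hleft := altConv_mul_left y (fun a => D (M a)) L m
  have hright := altConv_mul_right y L (fun b => D (M b)) m
  simp only [hM] at hleft hright
  rw [map_add, derivation_altConv, derivation_altConv]
  linear_combination y * hcancel - hleft - hright

end ShuffleEquations

open scoped PowerSeries
open PowerSeries (X coeff constantCoeff coeff_derivative)

/-- The polylogarithm `Li_w(X)` as a formal power series. Multiplication by `1 - X` undoes the
partial summation of coefficients, so the coefficients of `polylog w` sum to `H_w(N)`. -/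
def polylog (w : List ℕ) : ℝ⟦X⟧ := PowerSeries.mk (hsum w) * (1 - X)

theorem sum_range_coeff_polylog (w : List ℕ) (N : ℕ) :
    ∑ n ∈ Finset.range (N + 1), coeff n (polylog w) = hsum w N := by
  induction N with
  | zero => simp [polylog, mul_sub]
  | succ N ih =>
    rw [Finset.sum_range_succ, ih, polylog, mul_sub, mul_one, map_sub, PowerSeries.coeff_succ_mul_X,
      PowerSeries.coeff_mk, PowerSeries.coeff_mk, add_sub_cancel]

theorem coeff_succ_polylog_cons (s : ℕ) (w : List ℕ) (n : ℕ) :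
    coeff (n + 1) (polylog (s :: w)) = (((n + 1 : ℕ) : ℝ) ^ s)⁻¹ * hsum w n := by
  have h := sum_range_coeff_polylog (s :: w) (n + 1)
  rw [Finset.sum_range_succ, sum_range_coeff_polylog, hsum_cons_succ] at h
  exact add_left_cancel h

theorem constantCoeff_polylog_cons (s : ℕ) (w : List ℕ) : constantCoeff (polylog (s :: w)) = 0 := by
  simp [polylog]

theorem polylog_nil : polylog [] = 1 := PowerSeries.mk_one_mul_one_sub_eq_one ℝ

theorem coeff_polylog_nonneg (w : List ℕ) (n : ℕ) : 0 ≤ coeff n (polylog w) := by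
  cases n with
  | zero =>
    have h := sum_range_coeff_polylog w 0
    rw [Finset.sum_range_one] at h
    exact h ▸ hsum_nonneg w 0
  | succ n =>
    have h := sum_range_coeff_polylog w (n + 1)
    rw [Finset.sum_range_succ, sum_range_coeff_polylog] at h
    linarith [hsum_mono w n.le_succ]

theorem X_mul_derivative_polylog (s : ℕ) (w : List ℕ) :
    X * d⁄dX ℝ (polylog ((s + 1) :: w)) = polylog (s :: w) := by
  ext n
  cases n with
  | zero => simp [constantCoeff_polylog_cons]
  | succ n =>
    rw [PowerSeries.coeff_succ_X_mul, coeff_derivative, coeff_succ_polylog_cons,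
      coeff_succ_polylog_cons, pow_succ]
    push_cast
    field_simp

theorem one_sub_X_mul_derivative_polylog (w : List ℕ) :
    (1 - X) * d⁄dX ℝ (polylog (1 :: w)) = polylog w := by
  have hderiv : d⁄dX ℝ (polylog (1 :: w)) = PowerSeries.mk (hsum w) := by
    ext n
    rw [coeff_derivative, coeff_succ_polylog_cons, PowerSeries.coeff_mk]
    push_cast
    field_simp
  rw [hderiv, mul_comm, polylog]

theorem eq_smul_polylog_of_mul_derivative_eq {f u : ℝ⟦X⟧} {s : ℕ} {v w : List ℕ} {c : ℝ}
    (hu : u ≠ 0) (hv : u * d⁄dX ℝ (polylog (s :: v)) = polylog w)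
    (hf : u * d⁄dX ℝ f = c • polylog w) (hf₀ : constantCoeff f = 0) : f = c • polylog (s :: v) := by
  refine PowerSeries.derivative.ext (mul_left_cancel₀ hu ?_) ?_
  · rw [hf, Derivation.map_smul, mul_smul_comm, hv]
  · simp [hf₀, constantCoeff_polylog_cons]

theorem eq_smul_polylog_succ_cons {f : ℝ⟦X⟧} {s : ℕ} {w : List ℕ} {c : ℝ}
    (hf : X * d⁄dX ℝ f = c • polylog (s :: w)) (hf₀ : constantCoeff f = 0) :
    f = c • polylog ((s + 1) :: w) :=
  eq_smul_polylog_of_mul_derivative_eq PowerSeries.X_ne_zero (X_mul_derivative_polylog s w) hf hf₀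

theorem one_sub_X_ne_zero : (1 - X : ℝ⟦X⟧) ≠ 0 := fun h => by
  simpa using congrArg constantCoeff h

theorem eq_smul_polylog_one_cons {f : ℝ⟦X⟧} {w : List ℕ} {c : ℝ}
    (hf : (1 - X) * d⁄dX ℝ f = c • polylog w) (hf₀ : constantCoeff f = 0) :
    f = c • polylog (1 :: w) :=
  eq_smul_polylog_of_mul_derivative_eq one_sub_X_ne_zero (one_sub_X_mul_derivative_polylog w) hf hf₀

/-- The passage from `S = altConv L L m` to `m + 2` integrates four times, along the letters of
`y₃ y₁`, whose forms are `dx / x, dx / x, dx / (1 - x), dx / (1 - x)`. -/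
theorem altConv_polylog_add_two {m : ℕ} {w : List ℕ} {c : ℝ}
    (hS : altConv (fun k => polylog (List.replicate k 2))
      (fun k => polylog (List.replicate k 2)) m = c • polylog w) :
    altConv (fun k => polylog (List.replicate k 2))
      (fun k => polylog (List.replicate k 2)) (m + 2) = (-4 * c) • polylog (3 :: 1 :: w) := by
  set L : ℕ → ℝ⟦X⟧ := fun k => polylog (List.replicate k 2) with hL_def
  set M : ℕ → ℝ⟦X⟧ := fun k => polylog (1 :: List.replicate k 2)
  have hL₀ : d⁄dX ℝ (L 0) = 0 := by simp [hL_def, polylog_nil]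
  have hL (k : ℕ) : X * d⁄dX ℝ (L (k + 1)) = M k := X_mul_derivative_polylog 1 _
  have hM (k : ℕ) : (1 - X) * d⁄dX ℝ (M k) = L k := one_sub_X_mul_derivative_polylog _
  have hcL (k : ℕ) : constantCoeff (L (k + 1)) = 0 := constantCoeff_polylog_cons _ _
  have hcM (k : ℕ) : constantCoeff (M k) = 0 := constantCoeff_polylog_cons _ _
  have hadd : altConv L M m + altConv M L m = (2 * c) • polylog (1 :: w) := by
    refine eq_smul_polylog_one_cons ?_ (by simp [altConv, hcM])
    rw [mul_derivation_altConv_add PowerSeries.X_ne_zero hL₀ hL hM, hS, mul_smul, two_smul, two_mul]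
  have hshifted : altConv M M m = (2 * c) • polylog (1 :: 1 :: w) := by
    refine eq_smul_polylog_one_cons ?_ (by simp [altConv, hcM])
    rw [mul_derivation_altConv_shifted hM, hadd]
  have hsub : altConv M L (m + 1) - altConv L M (m + 1) = (-4 * c) • polylog (2 :: 1 :: w) := by
    refine eq_smul_polylog_succ_cons ?_ (by simp [altConv, hcM])
    rw [mul_derivation_altConv_sub hL₀ hL one_sub_X_ne_zero hM, hshifted, neg_mul, two_mul,
      ← two_smul ℝ, smul_smul, ← neg_smul]
    ring_nf
  refine eq_smul_polylog_succ_cons ?_ ?_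
  · rw [mul_derivation_altConv_self hL₀ hL, hsub]
  · rw [map_altConv, altConv_succ_left]
    simp [altConv, hcL]

theorem altConv_polylog_two_mul (n : ℕ) :
    altConv (fun k => polylog (List.replicate k 2))
      (fun k => polylog (List.replicate k 2)) (2 * n) =
        (-4 : ℝ) ^ n • polylog (wordPow [3, 1] n) := by
  induction n with
  | zero => simp [wordPow, polylog_nil]
  | succ n ih => rw [mul_add_one, altConv_polylog_add_two ih, wordPow_succ, pow_succ']; rfl

theorem Converges.hasSum_coeff_polylog {w : List ℕ} (h : Converges w) :
    HasSum (fun n => coeff n (polylog w)) (zeta w) := by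
  rw [hasSum_iff_tendsto_nat_of_nonneg (coeff_polylog_nonneg w), ← tendsto_add_atTop_iff_nat 1]
  exact h.tendsto_hsum.congr fun N => (sum_range_coeff_polylog w N).symm

theorem converges_of_summable_coeff_polylog {w : List ℕ}
    (h : Summable fun n => coeff n (polylog w)) : Converges w :=
  converges_of_hsum_le fun N =>
    (sum_range_coeff_polylog w N).symm.trans_le
      (h.sum_le_tsum _ fun n _ => coeff_polylog_nonneg w n)

theorem hasSum_coeff_mul {f g : ℝ⟦X⟧} {a b : ℝ} (hf : HasSum (fun n => coeff n f) a)
    (hg : HasSum (fun n => coeff n g) b) : HasSum (fun n => coeff n (f * g)) (a * b) := by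
  simp only [PowerSeries.coeff_mul]
  have hsum := (summable_norm_sum_mul_antidiagonal_of_summable_norm hf.summable.norm
    hg.summable.norm).of_norm.hasSum
  rwa [← tsum_mul_tsum_eq_tsum_sum_antidiagonal_of_summable_norm hf.summable.norm
    hg.summable.norm, hf.tsum_eq, hg.tsum_eq] at hsum

theorem hasSum_coeff_altConv {F G : ℕ → ℝ⟦X⟧} {a b : ℕ → ℝ}
    (hF : ∀ k, HasSum (fun n => coeff n (F k)) (a k))
    (hG : ∀ k, HasSum (fun n => coeff n (G k)) (b k)) (m : ℕ) :
    HasSum (fun n => coeff n (altConv F G m)) (altConv a b m) := by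
  simp only [altConv, map_sum]
  refine hasSum_sum fun p _ => ?_
  have hsign : ((-1 : ℝ⟦X⟧) ^ p.2) = PowerSeries.C ((-1) ^ p.2) := by simp
  simp only [mul_assoc, hsign, PowerSeries.coeff_C_mul]
  exact (hasSum_coeff_mul (hF p.1) (hG p.2)).mul_left _

theorem converges_wordPow_three_one_and_altConv_zeta (n : ℕ) :
    Converges (wordPow [3, 1] n) ∧
      altConv (fun k => zeta (List.replicate k 2)) (fun k => zeta (List.replicate k 2)) (2 * n) =
        (-4) ^ n * zeta (wordPow [3, 1] n) := by
  have hsum := hasSum_coeff_altConv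
    (fun k => (converges_replicate le_rfl k).hasSum_coeff_polylog)
    (fun k => (converges_replicate le_rfl k).hasSum_coeff_polylog) (2 * n)
  simp only [altConv_polylog_two_mul, PowerSeries.coeff_smul, smul_eq_mul] at hsum
  have hconv : Converges (wordPow [3, 1] n) := converges_of_summable_coeff_polylog <|
    (summable_mul_left_iff (by positivity)).1 hsum.summable
  exact ⟨hconv, hsum.unique (hconv.hasSum_coeff_polylog.mul_left _)⟩

theorem converges_wordPow_three_one (n : ℕ) : Converges (wordPow [3, 1] n) :=
  (converges_wordPow_three_one_and_altConv_zeta n).1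

theorem altConv_zeta_two_mul (n : ℕ) :
    altConv (fun k => zeta (List.replicate k 2)) (fun k => zeta (List.replicate k 2)) (2 * n) =
      (-4) ^ n * zeta (wordPow [3, 1] n) :=
  (converges_wordPow_three_one_and_altConv_zeta n).2

theorem altConv_self_eq_zero_of_odd {A : Type*} [CommRing A] [IsAddTorsionFree A] (F : ℕ → A)
    {m : ℕ} (hm : Odd m) : altConv F F m = 0 := by
  have h := altConv_comm F F m
  rw [hm.neg_one_pow, neg_one_mul] at h
  exact self_eq_neg.1 h

theorem hasSum_mul_starValue_zeta_two (c : ℂ) :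
    HasSum (fun n => (-4 * c ^ 2) ^ n * (zeta (wordPow [3, 1] n) : ℂ))
      (starValue zeta c [2] * starValue zeta (-c) [2]) := by
  have h := starConverges_zeta le_rfl c
  have h' := starConverges_zeta le_rfl (-c)
  have hcauchy := (summable_norm_sum_mul_antidiagonal_of_summable_norm h.norm
    h'.norm).of_norm.hasSum
  rw [← tsum_mul_tsum_eq_tsum_sum_antidiagonal_of_summable_norm h.norm h'.norm] at hcauchy
  have hcoeff (m : ℕ) : ∑ p ∈ antidiagonal m, c ^ p.1 * (zeta (wordPow [2] p.1) : ℂ) *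
      ((-c) ^ p.2 * (zeta (wordPow [2] p.2) : ℂ)) =
        c ^ m * (altConv (fun k => zeta (List.replicate k 2))
          (fun k => zeta (List.replicate k 2)) m : ℝ) := by
    rw [altConv, Complex.ofReal_sum, Finset.mul_sum]
    refine Finset.sum_congr rfl fun p hp => ?_
    rw [← mem_antidiagonal.1 hp, wordPow_singleton, wordPow_singleton, neg_pow, pow_add]
    push_cast
    ring
  simp only [hcoeff] at hcauchy
  refine ((mul_right_injective₀ (two_ne_zero' ℕ)).hasSum_iff fun m hm => ?_).2 hcauchy |>.congr_fun
    fun n => ?_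
  · rw [altConv_self_eq_zero_of_odd, Complex.ofReal_zero, mul_zero]
    rw [← Nat.not_even_iff_odd]
    exact fun hm' => hm (hm'.exists_two_nsmul m |>.imp fun j hj => by simpa using hj.symm)
  · rw [Function.comp_apply, altConv_zeta_two_mul, pow_mul, mul_pow]
    push_cast
    ring

theorem starValue_zeta_neg_sq {r : ℕ} (hr : 2 ≤ r) (c : ℂ) :
    starValue zeta (-c ^ 2) [2 * r] = starValue zeta c [r] * starValue zeta (-c) [r] := by
  refine tendsto_nhds_unique (tendsto_prod_starValue_zeta (by omega) _) <|
    ((tendsto_prod_starValue_zeta hr c).mul (tendsto_prod_starValue_zeta hr (-c))).congr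
      fun N => ?_
  rw [← Finset.prod_mul_distrib]
  refine Finset.prod_congr rfl fun j _ => ?_
  rw [pow_mul', ← inv_pow]
  ring

/-! ### Closed formulas -/

/-- The entire function `sin w / w`. -/
def csinc (w : ℂ) : ℂ := if w = 0 then 1 else Complex.sin w / w

@[simp] theorem csinc_zero : csinc 0 = 1 := if_pos rfl

theorem csinc_of_ne_zero {w : ℂ} (hw : w ≠ 0) : csinc w = Complex.sin w / w := if_neg hw

theorem hasSum_csinc (w : ℂ) :
    HasSum (fun k : ℕ => (-w ^ 2) ^ k / ((2 * k + 1).factorial : ℂ)) (csinc w) := by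
  rcases eq_or_ne w 0 with rfl | hw
  · simpa using hasSum_single (f := fun k : ℕ => (0 : ℂ) ^ k / ((2 * k + 1).factorial : ℂ)) 0
      fun k hk => by simp [hk]
  · rw [csinc_of_ne_zero hw]
    refine ((Complex.hasSum_sin w).div_const w).congr_fun fun k => ?_
    rw [neg_pow, ← pow_mul, pow_succ]
    field_simp

/-- Expand `2 * sin w * sin (I * w) = cos (w - I * w) - cos (w + I * w)`: the arguments have squares
`∓2 * I * w ^ 2`, so the terms of even index cancel and those of odd index double. -/
theorem hasSum_sin_mul_sin_I_mul (w : ℂ) :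
    HasSum (fun k : ℕ => Complex.I * (2 * (-4) ^ k * w ^ (4 * k + 2) / ((4 * k + 2).factorial : ℂ)))
      (Complex.sin w * Complex.sin (Complex.I * w)) := by
  have hminus (m : ℕ) : (w - Complex.I * w) ^ (2 * m) = (-1) ^ m * (2 * Complex.I * w ^ 2) ^ m := by
    rw [pow_mul, ← mul_pow]
    congr 1
    linear_combination w ^ 2 * Complex.I_sq
  have hplus (m : ℕ) : (w + Complex.I * w) ^ (2 * m) = (2 * Complex.I * w ^ 2) ^ m := by
    rw [pow_mul]
    congr 1
    linear_combination w ^ 2 * Complex.I_sq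
  have hcos : (Complex.cos (w - Complex.I * w) - Complex.cos (w + Complex.I * w)) / 2 =
      Complex.sin w * Complex.sin (Complex.I * w) := by
    rw [Complex.cos_sub, Complex.cos_add]
    ring
  have hinj : Function.Injective fun k : ℕ => 2 * k + 1 := fun i j h => by simpa using h
  rw [← hcos]
  refine ((hinj.hasSum_iff fun m hm => ?_).2 <| ((Complex.hasSum_cos _).sub
    (Complex.hasSum_cos _)).div_const 2).congr_fun fun k => ?_
  · have heven : Even m := Nat.not_odd_iff_even.1 fun ⟨k, hk⟩ => hm ⟨k, hk.symm⟩
    rw [hminus, hplus, heven.neg_one_pow, one_mul, sub_self, zero_div]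
  · have hodd : (-1 : ℂ) ^ (2 * k + 1) = -1 := Odd.neg_one_pow ⟨k, rfl⟩
    have hpow : (2 * Complex.I * w ^ 2) ^ (2 * k + 1) =
        2 * Complex.I * (-4) ^ k * w ^ (4 * k + 2) := by
      rw [pow_succ, pow_mul, show (2 * Complex.I * w ^ 2) ^ 2 = -4 * w ^ 4 by
        linear_combination 4 * w ^ 4 * Complex.I_sq]
      ring
    rw [Function.comp_apply, hminus, hplus, hodd, hpow, show 2 * (2 * k + 1) = 4 * k + 2 by ring]
    ring

theorem hasSum_csinc_mul_csinc_I_mul (w : ℂ) :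
    HasSum (fun k : ℕ => 2 * (-4) ^ k * w ^ (4 * k) / ((4 * k + 2).factorial : ℂ))
      (csinc w * csinc (Complex.I * w)) := by
  rcases eq_or_ne w 0 with rfl | hw
  · simpa using hasSum_single
      (f := fun k : ℕ => 2 * (-4) ^ k * (0 : ℂ) ^ (4 * k) / ((4 * k + 2).factorial : ℂ)) 0
      fun k hk => by simp [hk]
  · have hIw : Complex.I * w ≠ 0 := mul_ne_zero Complex.I_ne_zero hw
    rw [csinc_of_ne_zero hw, csinc_of_ne_zero hIw, div_mul_div_comm]
    refine ((hasSum_sin_mul_sin_I_mul w).div_const _).congr_fun fun k => ?_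
    have hI := Complex.I_ne_zero
    rw [pow_add]
    field_simp

theorem starValue_zeta_two_eq_csinc (t : ℂ) :
    starValue zeta (-t ^ 2) [2] = csinc (t * Real.pi) := by
  refine tendsto_nhds_unique (tendsto_prod_starValue_zeta le_rfl _) ?_
  rcases eq_or_ne t 0 with rfl | ht
  · simp
  have hπt : t * (Real.pi : ℂ) ≠ 0 := mul_ne_zero ht (Complex.ofReal_ne_zero.2 Real.pi_ne_zero)
  rw [csinc_of_ne_zero hπt, mul_comm t]
  refine ((Complex.tendsto_euler_sin_prod t).div_const (Real.pi * t)).congr fun N => ?_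
  rw [mul_div_cancel_left₀ _ (mul_comm t _ ▸ hπt)]
  refine Finset.prod_congr rfl fun j _ => ?_
  push_cast
  ring

theorem starValue_zeta_four_eq_mul (t : ℂ) :
    starValue zeta (-t ^ 4) [4] = starValue zeta (-t ^ 2) [2] * starValue zeta (t ^ 2) [2] := by
  have h := starValue_zeta_neg_sq le_rfl (t ^ 2)
  rw [← pow_mul] at h
  rw [mul_comm, ← h]

theorem starConverges_zeta_three_one (t : ℂ) : StarConverges zeta (-4 * t ^ 4) [3, 1] := by
  have h := hasSum_mul_starValue_zeta_two (t ^ 2)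
  rw [← pow_mul] at h
  exact h.summable

theorem starValue_zeta_four_eq_three_one (t : ℂ) :
    starValue zeta (-t ^ 4) [4] = starValue zeta (-4 * t ^ 4) [3, 1] := by
  have h := hasSum_mul_starValue_zeta_two (t ^ 2)
  rw [← pow_mul] at h
  rw [starValue_zeta_four_eq_mul, mul_comm, ← h.tsum_eq, starValue]

theorem starValue_zeta_four_eq_csinc_mul_csinc (t : ℂ) :
    starValue zeta (-t ^ 4) [4] = csinc (t * Real.pi) * csinc (Complex.I * (t * Real.pi)) := by
  have h := starValue_zeta_two_eq_csinc (Complex.I * t)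
  rw [mul_pow, Complex.I_sq, neg_one_mul, neg_neg, mul_assoc] at h
  rw [starValue_zeta_four_eq_mul, starValue_zeta_two_eq_csinc, h]

theorem hasSum_starValue_zeta_two (t : ℂ) :
    HasSum (fun k : ℕ => (t * Complex.I * Real.pi) ^ (2 * k) / ((2 * k + 1).factorial : ℂ))
      (starValue zeta (-t ^ 2) [2]) := by
  rw [starValue_zeta_two_eq_csinc]
  refine (hasSum_csinc _).congr_fun fun k => ?_
  rw [pow_mul]
  congr 2
  linear_combination t ^ 2 * Real.pi ^ 2 * Complex.I_sq

theorem hasSum_starValue_zeta_four (t : ℂ) :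
    HasSum (fun k : ℕ => 2 * (-4) ^ k * (t * Real.pi) ^ (4 * k) / ((4 * k + 2).factorial : ℂ))
      (starValue zeta (-t ^ 4) [4]) := by
  rw [starValue_zeta_four_eq_csinc_mul_csinc]
  exact hasSum_csinc_mul_csinc_I_mul _

theorem surjective_mul_pow {K : Type*} [Field K] [IsAlgClosed K] {d : K} (hd : d ≠ 0)
    {n : ℕ} (hn : n ≠ 0) : Function.Surjective fun t : K => d * t ^ n := fun z => by
  obtain ⟨t, ht⟩ := IsAlgClosed.exists_pow_nat_eq (z / d) (Nat.pos_of_ne_zero hn)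
  exact ⟨t, by simp only [ht, mul_div_cancel₀ z hd]⟩

theorem zeta_wordPow_eq_of_hasSum {w : List ℕ} {a : ℕ → ℝ} {φ : ℂ → ℂ}
    (hφ : Function.Surjective φ) (hw : ∀ t, StarConverges zeta (φ t) w)
    (ha : ∀ t, HasSum (fun k => φ t ^ k * (a k : ℂ)) (starValue zeta (φ t) w)) (k : ℕ) :
    zeta (wordPow w k) = a k := by
  have hzeta := taylorCoeff_eq_of_hasSum (f := fun z => starValue zeta z w) <|
    Eventually.of_forall <| hφ.forall.2 fun t => (hw t).hasSum
  have ha' := taylorCoeff_eq_of_hasSum (f := fun z => starValue zeta z w) <|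
    Eventually.of_forall <| hφ.forall.2 ha
  exact Complex.ofReal_injective (congrFun (hzeta.symm.trans ha') k)

theorem zeta_wordPow_two (k : ℕ) :
    zeta (wordPow [2] k) = Real.pi ^ (2 * k) / ((2 * k + 1).factorial : ℝ) := by
  refine zeta_wordPow_eq_of_hasSum (a := fun k => Real.pi ^ (2 * k) / ((2 * k + 1).factorial : ℝ))
    (surjective_mul_pow (neg_ne_zero.2 one_ne_zero) two_ne_zero)
    (fun t => starConverges_zeta le_rfl _) (fun t => ?_) k
  rw [neg_one_mul]
  refine (hasSum_starValue_zeta_two t).congr_fun fun k => ?_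
  push_cast
  rw [neg_pow (t ^ 2), mul_pow, mul_pow, pow_mul Complex.I, Complex.I_sq]
  ring

theorem zeta_wordPow_four (k : ℕ) :
    zeta (wordPow [4] k) = 4 ^ k * (2 * Real.pi ^ (4 * k) / ((4 * k + 2).factorial : ℝ)) := by
  refine zeta_wordPow_eq_of_hasSum
    (a := fun k => 4 ^ k * (2 * Real.pi ^ (4 * k) / ((4 * k + 2).factorial : ℝ)))
    (surjective_mul_pow (neg_ne_zero.2 one_ne_zero) four_ne_zero)
    (fun t => starConverges_zeta (by norm_num) _) (fun t => ?_) k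
  rw [neg_one_mul]
  refine (hasSum_starValue_zeta_four t).congr_fun fun k => ?_
  push_cast
  rw [neg_pow (t ^ 4), neg_pow 4]
  ring

theorem zeta_wordPow_three_one (k : ℕ) :
    zeta (wordPow [3, 1] k) = 2 * Real.pi ^ (4 * k) / ((4 * k + 2).factorial : ℝ) := by
  refine zeta_wordPow_eq_of_hasSum
    (a := fun k => 2 * Real.pi ^ (4 * k) / ((4 * k + 2).factorial : ℝ))
    (surjective_mul_pow (by norm_num : (-4 : ℂ) ≠ 0) four_ne_zero) starConverges_zeta_three_one
    (fun t => ?_) k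
  rw [← starValue_zeta_four_eq_three_one]
  refine (hasSum_starValue_zeta_four t).congr_fun fun k => ?_
  push_cast
  ring

theorem starValue_gammaReg_eq_inv_GammaY_root_mul {r : ℕ} (hr : 1 ≤ r) {ω : ℂ} (hω : ω ^ r = -1)
    {t : ℂ} (ht : ‖t‖ < 1) : starValue gammaReg (-t ^ r) [r] = (GammaY r (1 + ω * t))⁻¹ := by
  have hω₁ : ‖ω‖ = 1 := by
    rw [← pow_eq_one_iff_of_nonneg (norm_nonneg ω) (Nat.one_le_iff_ne_zero.1 hr), ← norm_pow, hω,
      norm_neg, norm_one]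
  rw [inv_GammaY_one_add hr (by rwa [norm_mul, hω₁, one_mul]), mul_pow, hω, neg_one_mul]

theorem starValue_zeta_two_eq_sin_div {t : ℂ} (ht : t ≠ 0) :
    starValue zeta (-t ^ 2) [2] = Complex.sin (t * Real.pi) / (t * Real.pi) := by
  have hπ : (Real.pi : ℂ) ≠ 0 := Complex.ofReal_ne_zero.2 Real.pi_ne_zero
  rw [starValue_zeta_two_eq_csinc, csinc_of_ne_zero (mul_ne_zero ht hπ)]

theorem starValue_zeta_four_eq_sin_div_mul_sin_div {t : ℂ} (ht : t ≠ 0) :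
    starValue zeta (-t ^ 4) [4] =
      Complex.sin (Complex.I * t * Real.pi) / (Complex.I * t * Real.pi) *
        (Complex.sin (t * Real.pi) / (t * Real.pi)) := by
  have hIt := starValue_zeta_two_eq_sin_div (mul_ne_zero Complex.I_ne_zero ht)
  rw [mul_pow, Complex.I_sq, neg_one_mul, neg_neg] at hIt
  rw [starValue_zeta_four_eq_mul, mul_comm, hIt, starValue_zeta_two_eq_sin_div ht]

section UnitDisc

variable {t : ℂ} (ht : ‖t‖ < 1)

include ht

theorem starValue_gammaReg_one_eq_inv_GammaY :
    starValue gammaReg t [1] = (GammaY 1 (1 + t))⁻¹ := by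
  rw [inv_GammaY_one_add le_rfl ht, pow_one]

theorem starValue_gammaReg_one_neg_eq_inv_GammaY :
    starValue gammaReg (-t) [1] = (GammaY 1 (1 - t))⁻¹ := by
  rw [sub_eq_add_neg, inv_GammaY_one_add le_rfl ((norm_neg t).trans_lt ht), pow_one]

theorem starValue_gammaReg_two_eq_inv_GammaY :
    starValue gammaReg (t ^ 2) [2] = (GammaY 2 (1 + t))⁻¹ :=
  (inv_GammaY_one_add one_le_two ht).symm

theorem starValue_gammaReg_two_neg_eq_inv_GammaY :
    starValue gammaReg (-t ^ 2) [2] = (GammaY 2 (1 + Complex.I * t))⁻¹ :=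
  starValue_gammaReg_eq_inv_GammaY_root_mul one_le_two Complex.I_sq ht

theorem starValue_gammaReg_four_eq_mul :
    starValue gammaReg (-t ^ 4) [4] =
      starValue gammaReg (t ^ 2) [2] * starValue gammaReg (-t ^ 2) [2] := by
  have h := starValue_gammaReg_neg_sq one_le_two (norm_pow_lt_one ht two_ne_zero)
  norm_num only [← pow_mul] at h
  exact h

theorem starValue_gammaReg_two_neg_eq_mul :
    starValue gammaReg (-t ^ 2) [2] = starValue gammaReg t [1] * starValue gammaReg (-t) [1] := by
  have h := starValue_gammaReg_neg_sq le_rfl ht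
  rwa [mul_one] at h

theorem inv_GammaY_two_eq_mul :
    (GammaY 2 (1 + Complex.I * t))⁻¹ = (GammaY 1 (1 + t))⁻¹ * (GammaY 1 (1 - t))⁻¹ := by
  rw [← starValue_gammaReg_two_neg_eq_inv_GammaY ht, ← starValue_gammaReg_one_eq_inv_GammaY ht,
    ← starValue_gammaReg_one_neg_eq_inv_GammaY ht, starValue_gammaReg_two_neg_eq_mul ht]

theorem inv_GammaY_four_eq_mul {ξ : ℂ} (hξ : ξ ^ 4 = -1) :
    (GammaY 4 (1 + ξ * t))⁻¹ = (GammaY 2 (1 + t))⁻¹ * (GammaY 2 (1 + Complex.I * t))⁻¹ := by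
  rw [← starValue_gammaReg_eq_inv_GammaY_root_mul (by norm_num) hξ ht,
    starValue_gammaReg_four_eq_mul ht, starValue_gammaReg_two_eq_inv_GammaY ht,
    starValue_gammaReg_two_neg_eq_inv_GammaY ht]

theorem exists_hasSum_riemannZeta_mul_pow_and_eq_exp {r : ℕ} (hr : 2 ≤ r) :
    ∃ L : ℂ,
      HasSum (fun k : ℕ => riemannZeta ((r * (k + 1) : ℕ) : ℂ) * t ^ (r * (k + 1)) /
        ((k + 1 : ℕ) : ℂ)) L ∧
      starValue gammaReg (-t ^ r) [r] = Complex.exp (-L) := by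
  refine ⟨-ellSeries r (-t ^ r), hasSum_riemannZeta_mul_pow hr ht, ?_⟩
  rw [neg_neg, starValue_gammaReg_eq_exp (by omega) (norm_neg_pow_lt_one ht (by omega))]

theorem exists_hasSum_and_inv_GammaY_two_eq_exp :
    ∃ L : ℂ,
      HasSum (fun k : ℕ => riemannZeta ((2 * (k + 1) : ℕ) : ℂ) * t ^ (2 * (k + 1)) /
        ((k + 1 : ℕ) : ℂ)) L ∧
      (GammaY 2 (1 + Complex.I * t))⁻¹ = Complex.exp (-L) ∧
      (t ≠ 0 → Complex.exp (-L) = Complex.sin (t * Real.pi) / (t * Real.pi)) := by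
  obtain ⟨L, hL, hexp⟩ := exists_hasSum_riemannZeta_mul_pow_and_eq_exp ht le_rfl
  refine ⟨L, hL, ?_, fun ht₀ => ?_⟩
  · rw [← starValue_gammaReg_two_neg_eq_inv_GammaY ht, hexp]
  · rw [← hexp, starValue_gammaReg_eq_zeta le_rfl, starValue_zeta_two_eq_sin_div ht₀]

theorem exists_hasSum_and_starValue_gammaReg_four_eq_exp :
    ∃ L : ℂ,
      HasSum (fun k : ℕ => riemannZeta ((4 * (k + 1) : ℕ) : ℂ) * t ^ (4 * (k + 1)) /
        ((k + 1 : ℕ) : ℂ)) L ∧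
      starValue gammaReg (-t ^ 4) [4] = Complex.exp (-L) ∧
      (t ≠ 0 → Complex.exp (-L) =
        Complex.sin (Complex.I * t * Real.pi) / (Complex.I * t * Real.pi) *
          (Complex.sin (t * Real.pi) / (t * Real.pi))) := by
  have h4 : 2 ≤ 4 := by norm_num
  obtain ⟨L, hL, hexp⟩ := exists_hasSum_riemannZeta_mul_pow_and_eq_exp ht h4
  refine ⟨L, hL, hexp, fun ht₀ => ?_⟩
  rw [← hexp, starValue_gammaReg_eq_zeta h4, starValue_zeta_four_eq_sin_div_mul_sin_div ht₀]

end UnitDisc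

theorem zeta_wordPow_two_div_pi_pow (k : ℕ) :
    zeta (wordPow [2] k) / Real.pi ^ (2 * k) = 1 / ((2 * k + 1).factorial : ℝ) := by
  rw [zeta_wordPow_two]
  field_simp

theorem zeta_wordPow_four_div_pi_pow (k : ℕ) :
    zeta (wordPow [4] k) / (4 ^ k * Real.pi ^ (4 * k)) = 2 / ((4 * k + 2).factorial : ℝ) := by
  rw [zeta_wordPow_four]
  field_simp

theorem zeta_wordPow_three_one_div_pi_pow (k : ℕ) :
    zeta (wordPow [3, 1] k) / Real.pi ^ (4 * k) = 2 / ((4 * k + 2).factorial : ℝ) := by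
  rw [zeta_wordPow_three_one]
  field_simp

theorem converges_wordPow_singleton {r : ℕ} (hr : 2 ≤ r) (k : ℕ) : Converges (wordPow [r] k) :=
  wordPow_singleton r k ▸ converges_replicate hr k

theorem isFinitePart_gammaReg_wordPow_singleton {r : ℕ} (hr : 1 ≤ r) (k : ℕ) :
    IsFinitePart (harmonicSum (wordPow [r] k)) (gammaReg (wordPow [r] k)) := by
  rw [harmonicSum_eq_hsum, wordPow_singleton]
  exact isFinitePart_gammaReg_replicate hr k

end Polyzeta

end

theorem mainTheorem12 :
    -- the finite parts that define `γ` exist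
    (∀ r : ℕ, 1 ≤ r → ∀ k : ℕ, Polyzeta.IsFinitePart
      (Polyzeta.harmonicSum (Polyzeta.wordPow [r] k))
      (Polyzeta.gammaReg (Polyzeta.wordPow [r] k))) ∧
    -- first family of regularization identities
    (∀ t : ℂ, ‖t‖ < 1 →
      (Polyzeta.StarConverges Polyzeta.gammaReg (-t ^ 2) [2] ∧
        Polyzeta.StarConverges Polyzeta.gammaReg t [1] ∧
        Polyzeta.StarConverges Polyzeta.gammaReg (-t) [1] ∧
        Polyzeta.StarConverges Polyzeta.zeta (-t ^ 2) [2]) ∧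
      Polyzeta.starValue Polyzeta.gammaReg (-t ^ 2) [2]
        = (Polyzeta.GammaY 2 (1 + Complex.I * t))⁻¹ ∧
      Polyzeta.starValue Polyzeta.gammaReg t [1] = (Polyzeta.GammaY 1 (1 + t))⁻¹ ∧
      Polyzeta.starValue Polyzeta.gammaReg (-t) [1] = (Polyzeta.GammaY 1 (1 - t))⁻¹ ∧
      Polyzeta.starValue Polyzeta.gammaReg (-t ^ 2) [2]
        = Polyzeta.starValue Polyzeta.gammaReg t [1]
          * Polyzeta.starValue Polyzeta.gammaReg (-t) [1] ∧
      (Polyzeta.GammaY 2 (1 + Complex.I * t))⁻¹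
        = (Polyzeta.GammaY 1 (1 + t))⁻¹ * (Polyzeta.GammaY 1 (1 - t))⁻¹ ∧
      (∃ L : ℂ,
        HasSum (fun k : ℕ => riemannZeta ((2 * (k + 1) : ℕ) : ℂ) * t ^ (2 * (k + 1))
          / ((k + 1 : ℕ) : ℂ)) L ∧
        (Polyzeta.GammaY 2 (1 + Complex.I * t))⁻¹ = Complex.exp (-L) ∧
        (t ≠ 0 → Complex.exp (-L) = Complex.sin (t * Real.pi) / (t * Real.pi))) ∧
      Polyzeta.starValue Polyzeta.gammaReg (-t ^ 2) [2]
        = Polyzeta.starValue Polyzeta.zeta (-t ^ 2) [2] ∧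
      HasSum (fun k : ℕ => (t * Complex.I * Real.pi) ^ (2 * k) / ((2 * k + 1).factorial : ℂ))
        (Polyzeta.starValue Polyzeta.zeta (-t ^ 2) [2])) ∧
    -- second family of regularization identities
    (∀ t : ℂ, ‖t‖ < 1 →
      (Polyzeta.StarConverges Polyzeta.gammaReg (-t ^ 4) [4] ∧
        Polyzeta.StarConverges Polyzeta.gammaReg (t ^ 2) [2] ∧
        Polyzeta.StarConverges Polyzeta.zeta (-t ^ 4) [4] ∧
        Polyzeta.StarConverges Polyzeta.zeta (t ^ 2) [2] ∧
        Polyzeta.StarConverges Polyzeta.zeta (-4 * t ^ 4) [3, 1]) ∧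
      (∀ ξ : ℂ, ξ ^ 4 = -1 →
        Polyzeta.starValue Polyzeta.gammaReg (-t ^ 4) [4]
          = (Polyzeta.GammaY 4 (1 + ξ * t))⁻¹ ∧
        (Polyzeta.GammaY 4 (1 + ξ * t))⁻¹
          = (Polyzeta.GammaY 2 (1 + t))⁻¹ * (Polyzeta.GammaY 2 (1 + Complex.I * t))⁻¹) ∧
      Polyzeta.starValue Polyzeta.gammaReg (t ^ 2) [2] = (Polyzeta.GammaY 2 (1 + t))⁻¹ ∧
      Polyzeta.starValue Polyzeta.gammaReg (-t ^ 4) [4]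
        = Polyzeta.starValue Polyzeta.gammaReg (t ^ 2) [2]
          * Polyzeta.starValue Polyzeta.gammaReg (-t ^ 2) [2] ∧
      (∃ L : ℂ,
        HasSum (fun k : ℕ => riemannZeta ((4 * (k + 1) : ℕ) : ℂ) * t ^ (4 * (k + 1))
          / ((k + 1 : ℕ) : ℂ)) L ∧
        Polyzeta.starValue Polyzeta.gammaReg (-t ^ 4) [4] = Complex.exp (-L) ∧
        (t ≠ 0 → Complex.exp (-L)
          = Complex.sin (Complex.I * t * Real.pi) / (Complex.I * t * Real.pi)
            * (Complex.sin (t * Real.pi) / (t * Real.pi)))) ∧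
      Polyzeta.starValue Polyzeta.gammaReg (-t ^ 4) [4]
        = Polyzeta.starValue Polyzeta.zeta (-t ^ 4) [4] ∧
      Polyzeta.starValue Polyzeta.gammaReg (t ^ 2) [2]
        = Polyzeta.starValue Polyzeta.zeta (t ^ 2) [2] ∧
      Polyzeta.starValue Polyzeta.zeta (-t ^ 4) [4]
        = Polyzeta.starValue Polyzeta.zeta (-t ^ 2) [2]
          * Polyzeta.starValue Polyzeta.zeta (t ^ 2) [2] ∧
      Polyzeta.starValue Polyzeta.zeta (-t ^ 4) [4]
        = Polyzeta.starValue Polyzeta.zeta (-4 * t ^ 4) [3, 1] ∧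
      HasSum (fun k : ℕ => 2 * (-4) ^ k * (t * Real.pi) ^ (4 * k)
          / ((4 * k + 2).factorial : ℂ))
        (Polyzeta.starValue Polyzeta.zeta (-t ^ 4) [4])) ∧
    -- the resulting values
    (∀ k : ℕ,
      (Polyzeta.Converges (Polyzeta.wordPow [2] k) ∧
        Polyzeta.Converges (Polyzeta.wordPow [4] k) ∧
        Polyzeta.Converges (Polyzeta.wordPow [3, 1] k)) ∧
      Polyzeta.zeta (Polyzeta.wordPow [2] k) / Real.pi ^ (2 * k)
        = 1 / ((2 * k + 1).factorial : ℝ) ∧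
      Polyzeta.zeta (Polyzeta.wordPow [4] k) / (4 ^ k * Real.pi ^ (4 * k))
        = Polyzeta.zeta (Polyzeta.wordPow [3, 1] k) / Real.pi ^ (4 * k) ∧
      Polyzeta.zeta (Polyzeta.wordPow [3, 1] k) / Real.pi ^ (4 * k)
        = 2 / ((4 * k + 2).factorial : ℝ) ∧
      (∃ q : ℚ, Polyzeta.zeta (Polyzeta.wordPow [2] k) / Real.pi ^ (2 * k) = q) ∧
      (∃ q : ℚ, Polyzeta.zeta (Polyzeta.wordPow [4] k) / (4 ^ k * Real.pi ^ (4 * k)) = q) ∧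
      (∃ q : ℚ, Polyzeta.zeta (Polyzeta.wordPow [3, 1] k) / Real.pi ^ (4 * k) = q)) := by
  open Polyzeta in
  refine ⟨fun r hr k => isFinitePart_gammaReg_wordPow_singleton hr k, fun t ht => ?_,
    fun t ht => ?_, fun k => ?_⟩
  · exact ⟨⟨starConverges_gammaReg one_le_two (norm_neg_pow_lt_one ht two_ne_zero),
        starConverges_gammaReg le_rfl ht, starConverges_gammaReg le_rfl ((norm_neg t).trans_lt ht),
        starConverges_zeta le_rfl _⟩,
      starValue_gammaReg_two_neg_eq_inv_GammaY ht, starValue_gammaReg_one_eq_inv_GammaY ht,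
      starValue_gammaReg_one_neg_eq_inv_GammaY ht, starValue_gammaReg_two_neg_eq_mul ht,
      inv_GammaY_two_eq_mul ht, exists_hasSum_and_inv_GammaY_two_eq_exp ht,
      starValue_gammaReg_eq_zeta le_rfl _, hasSum_starValue_zeta_two t⟩
  · have h4 : 2 ≤ 4 := by norm_num
    exact ⟨⟨starConverges_gammaReg (by norm_num) (norm_neg_pow_lt_one ht four_ne_zero),
        starConverges_gammaReg one_le_two (norm_pow_lt_one ht two_ne_zero),
        starConverges_zeta h4 _, starConverges_zeta le_rfl _, starConverges_zeta_three_one t⟩,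
      fun ξ hξ => ⟨starValue_gammaReg_eq_inv_GammaY_root_mul (by norm_num) hξ ht,
        inv_GammaY_four_eq_mul ht hξ⟩,
      starValue_gammaReg_two_eq_inv_GammaY ht, starValue_gammaReg_four_eq_mul ht,
      exists_hasSum_and_starValue_gammaReg_four_eq_exp ht, starValue_gammaReg_eq_zeta h4 _,
      starValue_gammaReg_eq_zeta le_rfl _, starValue_zeta_four_eq_mul t,
      starValue_zeta_four_eq_three_one t, hasSum_starValue_zeta_four t⟩
  · have h2 := zeta_wordPow_two_div_pi_pow k
    have h4 := zeta_wordPow_four_div_pi_pow k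
    have h31 := zeta_wordPow_three_one_div_pi_pow k
    exact ⟨⟨converges_wordPow_singleton le_rfl k, converges_wordPow_singleton (by norm_num) k,
        converges_wordPow_three_one k⟩, h2, h4.trans h31.symm, h31,
      ⟨1 / (2 * k + 1).factorial, by rw [h2]; push_cast; rfl⟩,
      ⟨2 / (4 * k + 2).factorial, by rw [h4]; push_cast; rfl⟩,
      ⟨2 / (4 * k + 2).factorial, by rw [h31]; push_cast; rfl⟩⟩
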